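/- **Network and policy.** Let $\mathbb J$ (resources) and $\mathbb I$ (routes) be finite nonempty sets; each route uses a nonempty set of resources. Let $A$ be the $\mathbb J\times\mathbb I$ incidence matrix ($A_{ji}=1$ if route $i$ uses resource $j$, and $0$ otherwise), assumed to have full row rank, and let $C_j\in(0,\infty)$, $j\in\mathbb J$, be capacities. Fix $\alpha\in(0,\infty)$ and weights $\kappa_i>0$. For $n\in\mathbb R_+^{\mathbb I}$ let $\Lambda(n)\in\mathbb R_+^{\mathbb I}$ be the weighted $\alpha$-fair allocation: $\Lambda_i(n)=0$ if $n_i=0$, and $(\Lambda_i(n))_{i:\,n_i>0}$ is the unique maximizer of $\sum_{i:\,n_i>0}\kappa_i n_i^\alpha\,\Lambda_i^{1-\alpha}/(1-\alpha)$ (of $\sum_{i:\,n_i>0}\kappa_i n_i\log\Lambda_i$ if $\alpha=1$) over $\Lambda_i\ge 0$ with $\sum_{i:\,n_i>0}A_{ji}\Lambda_i\le C_j$ for all $j$; the objective is $-\infty$ if $\alpha\ge 1$ and $\Lambda_i=0$ for some $i$ with $n_i>0$. **Models.** Let $r$ run through an increasing sequence of positive numbers tending to infinity. For each $r$ let $\nu_i^r,\mu_i^r>0$,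 and, on some probability space, let $N^r$ be a process with values in $\mathbb Z_+^{\mathbb I}$ and right-continuous paths with left limits such that almost surely, for all $i\in\mathbb I$ and $t\ge0$, $$N^r_i(t)=N^r_i(0)+E^r_i(t)-S^r_i\Big(\int_0^t\Lambda_i(N^r(s))\,ds\Big),$$ where $E^r_i(t)=\sup\{n\ge0:\sum_{l=1}^n\xi^r_i(l)\le t\}$ and $S^r_i(t)=\sup\{n\ge0:\sum_{l=1}^n\zeta^r_i(l)\le t\}$, the variables $\xi^r_i(l)$ and $\zeta^r_i(l)$ ($i\in\mathbb I$, $l\ge1$) are exponentially distributed with means $1/\nu^r_i$ and $1/\mu_i^r$ respectively, they are all mutually independent, and they are independent of $N^r(0)$. Set $W^r(t)=A\,\mathrm{diag}(\mu^r)^{-1}N^r(t)$, $\hat N^r(t)=N^r(r^2t)/r$ and $\hat W^r(t)=W^r(r^2t)/r$. **Heavy traffic.** Assume that there are $\nu,\mu\in(0,\infty)^{\mathbb I}$ and $\theta\in\mathbb R^{\mathbb J}$ such that, as $r\to\infty$, $\nu^r\to\nu$, $\mu^r\to\mu$ and $r(A\rho^r-C)\to\theta$, where $\rho_i^r=\nu_i^r/\mu_i^r$.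 **Lifting map.** For $w\in\mathbb R_+^{\mathbb J}$ let $\Delta(w)$ be the unique minimizer of $$F(n)=\frac1{\alpha+1}\sum_{i\in\mathbb I}\nu_i\kappa_i\mu_i^{\alpha-1}\Big(\frac{n_i}{\nu_i}\Big)^{\alpha+1}$$ over $n\in\mathbb R_+^{\mathbb I}$ with $\sum_{i\in\mathbb I} A_{ji}n_i/\mu_i\ge w_j$ for all $j\in\mathbb J$. **Theorem 5.1.** Let $|\cdot|$ be the Euclidean norm and $\|x\|_T=\sup_{0\le t\le T}|x(t)|$. If $|\hat N^r(0)-\Delta(\hat W^r(0))|\to0$ in probability as $r\to\infty$, then multiplicative state space collapse holds: for each $T>0$, $$\frac{\|\hat N^r-\Delta(\hat W^r)\|_T}{\|\hat N^r\|_T\vee1}\to0\quad\text{in probability as } r\to\infty.$$ -/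

import Mathlib

open MeasureTheory ProbabilityTheory Filter Topology

namespace FlowLevel

noncomputable section

/-! ### Norms and convergence in probability -/

/-- The Euclidean norm of a vector indexed by a finite set. -/
def eucl {ι : Type*} [Fintype ι] (x : ι → ℝ) : ℝ :=
  ‖(WithLp.toLp 2 x : EuclideanSpace ℝ ι)‖

/-- `supNorm T x = sup_{0 ≤ t ≤ T} |x(t)|` for a vector-valued path `x` (used for `T > 0` and for
paths that are bounded on `[0, T]`). -/
def supNorm {ι : Type*} [Fintype ι] (T : ℝ) (x : ℝ → ι → ℝ) : ℝ :=
  ⨆ t : Set.Icc (0 : ℝ) T, eucl (x t)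

/-- `X l → 0` in probability as `l → ∞`, where the real random variables `X l` may live on
different probability spaces. -/
def TendstoZeroInProb {Ω : ℕ → Type*} [∀ l, MeasurableSpace (Ω l)] (P : ∀ l, Measure (Ω l))
    (X : ∀ l, Ω l → ℝ) : Prop :=
  ∀ ε : ℝ, 0 < ε → Tendsto (fun l => P l {ω | ε ≤ |X l ω|}) atTop (𝓝 0)

/-- Sample paths on `[0, ∞)` that are right-continuous with finite left limits. -/
def IsRcll {E : Type*} [TopologicalSpace E] (x : ℝ → E) : Prop :=
  (∀ t : ℝ, 0 ≤ t → ContinuousWithinAt x (Set.Ici t) t) ∧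
    ∀ t : ℝ, 0 < t → ∃ y : E, Tendsto x (𝓝[<] t) (𝓝 y)

/-! ### Network structure -/

/-- The incidence matrix: `A j i = 1` if resource `j` is used by route `i`, and `0` otherwise. -/
def incidence {I J : Type*} [DecidableEq J] (route : I → Finset J) : Matrix J I ℝ :=
  Matrix.of fun j i => if j ∈ route i then 1 else 0

/-- A network with resources `J` and routes `I`: each route uses a nonempty set of resources, the
incidence matrix has full row rank, and the resources have positive finite capacities. -/
structure Network (I J : Type*) [Fintype I] [Fintype J] [DecidableEq J] where
  route : I → Finset J
  route_nonempty : ∀ i, (route i).Nonempty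
  full_row_rank : (incidence route).rank = Fintype.card J
  capacity : J → ℝ
  capacity_pos : ∀ j, 0 < capacity j

section Policy

variable {I J : Type*} [Fintype I] [Fintype J] [DecidableEq J]

/-- The incidence matrix of a network. -/
def Network.A (net : Network I J) : Matrix J I ℝ := incidence net.route

/-! ### Weighted α-fair bandwidth sharing -/

/-- The objective `G_n(x)`, a sum over the routes `i` with `n_i > 0`; it is `-∞` if `α ≥ 1` and
`x_i = 0` for some such route. -/
def fairObjective (α : ℝ) (κ n x : I → ℝ) : EReal :=
  open Classical in
  if 1 ≤ α ∧ ∃ i, 0 < n i ∧ x i = 0 then ⊥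
  else if α = 1 then ((∑ i with 0 < n i, κ i * n i * Real.log (x i) : ℝ) : EReal)
  else ((∑ i with 0 < n i, κ i * n i ^ α * (x i ^ (1 - α) / (1 - α)) : ℝ) : EReal)

/-- Feasible allocations in state `n`: no bandwidth for empty routes, nonnegative bandwidth
for the others, and no resource is used beyond its capacity. -/
def IsFeasible (net : Network I J) (n x : I → ℝ) : Prop :=
  (∀ i, n i = 0 → x i = 0) ∧ (∀ i, 0 ≤ x i) ∧
    ∀ j, ∑ i with 0 < n i, net.A j i * x i ≤ net.capacity j

/-- `x` is a weighted `α`-fair allocation in state `n`. -/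
def IsFairAllocation (net : Network I J) (α : ℝ) (κ n x : I → ℝ) : Prop :=
  IsFeasible net n x ∧
    ∀ y, IsFeasible net n y → fairObjective α κ n y ≤ fairObjective α κ n x

/-- The bandwidth allocation function `Λ` on nonnegative vectors: `Λ(n)` is the (unique) weighted
`α`-fair allocation in state `n`. -/
def allocation (net : Network I J) (α : ℝ) (κ n : I → ℝ) : I → ℝ :=
  Classical.epsilon (IsFairAllocation net α κ n)

/-! ### Workload and lifting map -/

/-- The workload `A diag(μ)⁻¹ n` associated with `n`. -/
def workload (net : Network I J) (μ n : I → ℝ) : J → ℝ :=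
  fun j => ∑ i, net.A j i * (n i / μ i)

/-- The objective `F` of the problem that defines the lifting map. -/
def liftObjective (α : ℝ) (κ ν μ n : I → ℝ) : ℝ :=
  1 / (α + 1) * ∑ i, ν i * κ i * μ i ^ (α - 1) * (n i / ν i) ^ (α + 1)

/-- `n` minimizes `F` among the nonnegative vectors whose workload is at least `w`. -/
def IsLift (net : Network I J) (α : ℝ) (κ ν μ : I → ℝ) (w : J → ℝ) (n : I → ℝ) : Prop :=
  ((∀ i, 0 ≤ n i) ∧ ∀ j, w j ≤ workload net μ n j) ∧
    ∀ m : I → ℝ, ((∀ i, 0 ≤ m i) ∧ ∀ j, w j ≤ workload net μ m j) →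
      liftObjective α κ ν μ n ≤ liftObjective α κ ν μ m

/-- The lifting map `Δ` on nonnegative vectors: `Δ(w)` is the (unique) minimizer of `F` among the
nonnegative vectors whose workload is at least `w`. -/
def lift (net : Network I J) (α : ℝ) (κ ν μ : I → ℝ) (w : J → ℝ) : I → ℝ :=
  Classical.epsilon (IsLift net α κ ν μ w)

end Policy

/-! ### The stochastic model -/

/-- The counting process `sup {n ≥ 0 : ξ(1) + ... + ξ(n) ≤ t}` of a sequence of interarrival times
(here indexed from `0`). -/
def renewalCount (ξ : ℕ → ℝ) (t : ℝ) : ℕ :=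
  sSup {n : ℕ | ∑ l ∈ Finset.range n, ξ l ≤ t}

section Model

variable {I J : Type*} [Fintype I] [Fintype J] [DecidableEq J]

/-- A flow-level model with arrival rates `ν` and mean document sizes `1 / μ_i` operating under the
weighted `α`-fair policy, on the probability space `(Ω, P)`. The flow count process
is related to the exponential interarrival times and document sizes through
`N_i(t) = N_i(0) + E_i(t) - S_i(T_i(t))`, `T_i(t) = ∫_0^t Λ_i(N(s)) ds`, where `E_i` and `S_i` are
the counting processes of the interarrival times and of the document sizes. -/
structure Model (net : Network I J) (α : ℝ) (κ ν μ : I → ℝ) {Ω : Type*} [MeasurableSpace Ω]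
    (P : Measure Ω) where
  /-- interarrival times of documents -/
  interarrival : I → ℕ → Ω → ℝ
  /-- document sizes -/
  docSize : I → ℕ → Ω → ℝ
  /-- the flow count process `N` -/
  count : ℝ → Ω → I → ℕ
  measurable_interarrival : ∀ i k, Measurable (interarrival i k)
  measurable_docSize : ∀ i k, Measurable (docSize i k)
  measurable_count : ∀ t, Measurable (count t)
  law_interarrival : ∀ i k, P.map (interarrival i k) = expMeasure (ν i)
  law_docSize : ∀ i k, P.map (docSize i k) = expMeasure (μ i)
  /-- all interarrival times and document sizes are mutually independent -/
  indep_primitives :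
    iIndepFun (fun x : (I × ℕ) ⊕ (I × ℕ) =>
      Sum.elim (fun p => interarrival p.1 p.2) (fun p => docSize p.1 p.2) x) P
  /-- they are independent of the initial state -/
  indep_initial :
    IndepFun (count 0)
      (fun ω (x : (I × ℕ) ⊕ (I × ℕ)) =>
        Sum.elim (fun p => interarrival p.1 p.2 ω) (fun p => docSize p.1 p.2 ω) x) P
  rcll : ∀ ω, IsRcll fun t => count t ω
  dynamics : ∀ᵐ ω ∂P, ∀ i, ∀ t : ℝ, 0 ≤ t →
    (count t ω i : ℤ) = (count 0 ω i : ℤ) + (renewalCount (fun k => interarrival i k ω) t : ℤ)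
      - (renewalCount (fun k => docSize i k ω)
          (∫ s in (0 : ℝ)..t, allocation net α κ (fun i' => (count s ω i' : ℝ)) i) : ℤ)

variable {net : Network I J} {α : ℝ} {κ ν μ : I → ℝ} {Ω : Type*} [MeasurableSpace Ω]
  {P : Measure Ω}

/-- The diffusion scaled flow count process `N(r² t) / r`. -/
def Model.scaledCount (S : Model net α κ ν μ P) (r t : ℝ) (ω : Ω) : I → ℝ :=
  fun i => (S.count (r ^ 2 * t) ω i : ℝ) / r

/-- The workload process `A diag(μ)⁻¹ N(t)`. -/
def Model.work (S : Model net α κ ν μ P) (t : ℝ) (ω : Ω) : J → ℝ :=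
  workload net μ fun i => (S.count t ω i : ℝ)

/-- The diffusion scaled workload process `W(r² t) / r`. -/
def Model.scaledWork (S : Model net α κ ν μ P) (r t : ℝ) (ω : Ω) : J → ℝ :=
  fun j => S.work (r ^ 2 * t) ω j / r

end Model

/-! ### Multiplicative state space collapse -/

section Collapse

variable {I J : Type*} [Fintype I] [Fintype J] [DecidableEq J]

/-- Heavy traffic: `ν^r → ν`, `μ^r → μ` with positive limits and `r (A ρ^r - C) → θ`, where
`ρ^r_i = ν^r_i / μ^r_i`. -/
def HeavyTraffic (net : Network I J) (r : ℕ → ℝ) (νs μs : ℕ → I → ℝ) (ν μ : I → ℝ)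
    (θ : J → ℝ) : Prop :=
  (∀ i, 0 < ν i) ∧ (∀ i, 0 < μ i) ∧
    Tendsto νs atTop (𝓝 ν) ∧ Tendsto μs atTop (𝓝 μ) ∧
    Tendsto (fun l j => r l * (∑ i, net.A j i * (νs l i / μs l i) - net.capacity j)) atTop (𝓝 θ)

variable {net : Network I J} {α : ℝ} {κ : I → ℝ} {νs μs : ℕ → I → ℝ}
  {Ω : ℕ → Type*} [∀ l, MeasurableSpace (Ω l)] {P : ∀ l, Measure (Ω l)}

/-- Multiplicative state space collapse for a sequence of flow-level models with scale parameters
`r l`, the lifting map being taken with the limiting parameters `ν`, `μ`. -/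
def MultiplicativeCollapse (r : ℕ → ℝ) (S : ∀ l, Model net α κ (νs l) (μs l) (P l))
    (ν μ : I → ℝ) : Prop :=
  ∀ T : ℝ, 0 < T → TendstoZeroInProb P fun l ω =>
    supNorm T (fun t => (S l).scaledCount (r l) t ω
        - lift net α κ ν μ ((S l).scaledWork (r l) t ω))
      / max (supNorm T fun t => (S l).scaledCount (r l) t ω) 1

end Collapse

end

end FlowLevel

/-!
# Multiplicative state space collapse under weighted `α`-fair sharing

Let `F` be the cost that the lifting map `Δ` minimizes and let `w(n)` be the workload of `n`. The
proof is a Lyapunov argument with `costGap n = F(n) - F(Δ(w(n)))`, carried out directly on the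
prelimit sample paths; fluid limits and their compactness do not enter.

**Static part.** By heavy traffic `Aρ = C` with `ρ_i = ν_i / μ_i`, so `ρ` is an admissible
allocation. Write `G` for the concave objective that the fair allocation `Λ(n)` maximizes. Since
`∂_i G(ρ) = μ_i ∂_i F(n)`, the drift `∇F(n) · (ν - μΛ(n))` of the cost equals `∇G(ρ) · (ρ - Λ(n))`,
and `G(z) ≤ G(Λ(n))` together with two tangent inequalities bounds it by `∇G(z) · (ρ - z)` for every
positive admissible `z` (`isFairRate_allocation`). The choice `z = ρ + σ (n - Δ(w(n))) / μ` is
admissible because the workload of `Δ(w(n))` is at least that of `n`, and convexity of `F` turns the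
bound into `-σ costGap(n) + o(σ)`: on bounded sets of states the drift is bounded away
from zero as long as the Lyapunov function is (`exists_drift_le`). Moreover, on such
sets, `costGap n` is small exactly when `n` is close to `Δ(w(n))`, by uniform strict
convexity of `F` (`exists_near_lift_of_costGap_le`, `exists_costGap_le_of_near_lift`).

**Dynamic part.** Capacities equal to the offered load make the workload of a fluid path
nondecreasing, hence `F(Δ(w))` too, while `F` decreases. Both hold for approximate fluid paths up
to an error that can be made small compared with the decrease of `F` over a short time step, so
`costGap` stays small for all times if it is small initially
(`exists_costGap_le_of_isNearFluid`). Nothing in this bound depends on the length of the time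
interval.

**Stochastic part.** A Chernoff bound over all pairs of indices shows that, with probability
tending to one, the arrival and service counts keep to their rates over time `O(r ^ 2)`, with an
error `e * (r + elapsed time)` (`tendsto_measure_not_hasRate`). On that event, dividing the flow
counts by `Y = r * max (supNorm T N̂) 1` and accelerating time by the same factor gives an
approximate fluid path in the unit cube (`isNearFluid_of_hasRate`), and the conclusion is obtained
on the scale of the denominator `max (supNorm T N̂) 1` (`exists_collapse_of_hasRate`).
-/

namespace FlowLevel

/-! ### Finite families of constants -/

theorem exists_pos_forall_le {ι : Type*} [Finite ι] (f : ι → ℝ) (hf : ∀ i, 0 < f i) :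
    ∃ δ > 0, ∀ i, δ ≤ f i := by
  cases isEmpty_or_nonempty ι
  · exact ⟨1, one_pos, fun i => isEmptyElim i⟩
  · obtain ⟨i, hi⟩ := Finite.exists_min f
    exact ⟨f i, hf i, hi⟩

theorem exists_pos_forall_ge {ι : Type*} [Finite ι] (f : ι → ℝ) :
    ∃ M > 0, ∀ i, f i ≤ M := by
  obtain ⟨M, hM⟩ := Finite.bddAbove_range f
  exact ⟨max M 1, by positivity, fun i => (hM ⟨i, rfl⟩).trans (le_max_left _ _)⟩

/-! ### Estimates for real powers -/

/-- The tangent inequality of the convex function `x ↦ x ^ (α + 1)` on `[0, ∞)`. -/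
theorem rpow_tangent_le {α a b : ℝ} (hα : 0 < α) (ha : 0 ≤ a) (hb : 0 ≤ b) :
    b ^ (α + 1) + (α + 1) * b ^ α * (a - b) ≤ a ^ (α + 1) := by
  rcases hb.eq_or_lt with rfl | hb'
  · rw [Real.zero_rpow (by linarith), Real.zero_rpow hα.ne']
    simpa using Real.rpow_nonneg ha _
  · have h := one_add_mul_self_le_rpow_one_add (s := a / b - 1) (p := α + 1)
      (by have := div_nonneg ha hb; linarith) (by linarith)
    have h2 : (1 + (a / b - 1)) ^ (α + 1) = a ^ (α + 1) / b ^ (α + 1) := by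
      rw [← Real.div_rpow ha hb]; ring_nf
    have hpos : 0 < b ^ (α + 1) := Real.rpow_pos_of_pos hb' _
    rw [h2, le_div_iff₀ hpos, Real.rpow_add hb', Real.rpow_one] at h
    rw [Real.rpow_add hb' α 1, Real.rpow_one]
    have h3 : (1 + (α + 1) * (a / b - 1)) * (b ^ α * b)
        = b ^ α * b + (α + 1) * b ^ α * (a - b) := by
      field_simp
    linarith

theorem rpow_midpoint_le {p a b : ℝ} (hp : 1 < p) (ha : 0 ≤ a) (hb : 0 ≤ b) :
    2 * ((a + b) / 2) ^ p ≤ a ^ p + b ^ p := by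
  have h := (convexOn_rpow hp.le).2 (Set.mem_Ici.2 ha) (Set.mem_Ici.2 hb)
    (by norm_num : (0 : ℝ) ≤ 1 / 2) (by norm_num : (0 : ℝ) ≤ 1 / 2) (by norm_num)
  simp only [smul_eq_mul] at h
  rw [show (1 / 2 * a + 1 / 2 * b : ℝ) = (a + b) / 2 by ring] at h
  linarith

/-- Uniform strict convexity of `x ↦ x ^ p` on bounded intervals, in midpoint form. -/
theorem exists_rpow_midpoint_gap {p : ℝ} (hp : 1 < p) (M ε : ℝ) (hε : 0 < ε) :
    ∃ δ > 0, ∀ a b : ℝ, 0 ≤ a → a ≤ M → 0 ≤ b → b ≤ M → ε ≤ |a - b| →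
      δ ≤ a ^ p + b ^ p - 2 * ((a + b) / 2) ^ p := by
  let S : Set (ℝ × ℝ) := (Set.Icc 0 M ×ˢ Set.Icc 0 M) ∩ {x | ε ≤ |x.1 - x.2|}
  have hS : IsCompact S := (isCompact_Icc.prod isCompact_Icc).inter_right
    (isClosed_le continuous_const (by fun_prop))
  have hc : Continuous fun x : ℝ × ℝ => x.1 ^ p + x.2 ^ p - 2 * ((x.1 + x.2) / 2) ^ p := by
    have h0 : Continuous fun x : ℝ => x ^ p :=
      continuous_id.rpow_const fun _ => Or.inr (by linarith)
    exact ((h0.comp continuous_fst).add (h0.comp continuous_snd)).sub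
      (continuous_const.mul (h0.comp ((continuous_fst.add continuous_snd).div_const 2)))
  rcases S.eq_empty_or_nonempty with h | h
  · refine ⟨1, one_pos, fun a b ha haM hb hbM hab => ?_⟩
    have : (a, b) ∈ S := ⟨⟨⟨ha, haM⟩, ⟨hb, hbM⟩⟩, hab⟩
    simp [h] at this
  · obtain ⟨x, hx, hmin⟩ := hS.exists_isMinOn h hc.continuousOn
    refine ⟨_, ?_, fun a b ha haM hb hbM hab => hmin (show (a, b) ∈ S from
      ⟨⟨⟨ha, haM⟩, ⟨hb, hbM⟩⟩, hab⟩)⟩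
    have hne : x.1 ≠ x.2 := by
      intro h
      have := hx.2
      simp only [Set.mem_ofPred_eq, h, sub_self, abs_zero] at this
      linarith
    have h := (strictConvexOn_rpow hp).2 (Set.mem_Ici.2 hx.1.1.1) (Set.mem_Ici.2 hx.1.2.1) hne
      (by norm_num : (0 : ℝ) < 1 / 2) (by norm_num : (0 : ℝ) < 1 / 2) (by norm_num)
    simp only [smul_eq_mul] at h
    rw [show (1 / 2 * x.1 + 1 / 2 * x.2 : ℝ) = (x.1 + x.2) / 2 by ring] at h
    show 0 < x.1 ^ p + x.2 ^ p - 2 * ((x.1 + x.2) / 2) ^ p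
    linarith

theorem exists_rpow_modulus {α : ℝ} (hα : 0 < α) (M ε : ℝ) (hε : 0 < ε) :
    ∃ δ > 0, ∀ a b : ℝ, 0 ≤ a → a ≤ M → 0 ≤ b → b ≤ M → |a - b| ≤ δ → |a ^ α - b ^ α| ≤ ε := by
  have h := isCompact_Icc (a := (0 : ℝ)) (b := M) |>.uniformContinuousOn_of_continuous
    (f := fun x : ℝ => x ^ α) (continuous_id.rpow_const fun _ => Or.inr hα.le).continuousOn
  obtain ⟨δ, hδ, h⟩ := Metric.uniformContinuousOn_iff.1 h ε hε
  refine ⟨δ / 2, half_pos hδ, fun a b ha haM hb hbM hab => ?_⟩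
  have := h a ⟨ha, haM⟩ b ⟨hb, hbM⟩ (by rw [Real.dist_eq]; linarith)
  rw [Real.dist_eq] at this
  exact this.le

/-! ### The cost function of the lifting map -/

/-- The positivity assumptions on the parameters of the lifting map. -/
structure PosParams {I : Type*} (α : ℝ) (κ ν μ : I → ℝ) : Prop where
  alpha : 0 < α
  kappa : ∀ i, 0 < κ i
  nu : ∀ i, 0 < ν i
  mu : ∀ i, 0 < μ i

section Lift

variable {I : Type*}

/-- The gradient of `liftObjective`. -/
noncomputable def liftGradient (α : ℝ) (κ ν μ n : I → ℝ) : I → ℝ :=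
  fun i => κ i * μ i ^ (α - 1) * (n i / ν i) ^ α

variable {α : ℝ} {κ ν μ : I → ℝ}

theorem liftGradient_nonneg (hp : PosParams α κ ν μ) {n : I → ℝ} (hn : ∀ i, 0 ≤ n i) (i : I) :
    0 ≤ liftGradient α κ ν μ n i := by
  have h1 := hp.kappa i
  have h2 := hp.mu i
  have h3 := hp.nu i
  have h4 := hn i
  unfold liftGradient
  positivity

theorem mul_liftGradient (hp : PosParams α κ ν μ) {n : I → ℝ} (hn : ∀ i, 0 ≤ n i) (i : I) :
    μ i * liftGradient α κ ν μ n i = κ i * n i ^ α * (ν i / μ i) ^ (-α) := by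
  have h1 := hp.mu i
  have h2 := hp.nu i
  unfold liftGradient
  rw [Real.div_rpow (hn i) h2.le, Real.rpow_neg (by positivity), Real.div_rpow h2.le h1.le,
    Real.rpow_sub h1, Real.rpow_one]
  have := Real.rpow_pos_of_pos h1 α
  have := Real.rpow_pos_of_pos h2 α
  field_simp

variable [Fintype I]

theorem liftObjective_tangent_le (hp : PosParams α κ ν μ) {a b : I → ℝ} (ha : ∀ i, 0 ≤ a i)
    (hb : ∀ i, 0 ≤ b i) :
    liftObjective α κ ν μ b + ∑ i, liftGradient α κ ν μ b i * (a i - b i)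
      ≤ liftObjective α κ ν μ a := by
  unfold liftObjective liftGradient
  rw [Finset.mul_sum, Finset.mul_sum, ← Finset.sum_add_distrib]
  refine Finset.sum_le_sum fun i _ => ?_
  have h1 := hp.nu i
  have h2 := hp.alpha
  have h := rpow_tangent_le hp.alpha (div_nonneg (ha i) h1.le) (div_nonneg (hb i) h1.le)
  have hc : 0 ≤ 1 / (α + 1) * (ν i * κ i * μ i ^ (α - 1)) := by
    have := hp.kappa i
    have := hp.mu i
    positivity
  have h3 := mul_le_mul_of_nonneg_left h hc
  refine le_trans (le_of_eq ?_) (h3.trans (le_of_eq (by ring)))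
  field_simp

theorem liftObjective_mono (hp : PosParams α κ ν μ) {a b : I → ℝ} (ha : ∀ i, 0 ≤ a i)
    (hab : ∀ i, a i ≤ b i) : liftObjective α κ ν μ a ≤ liftObjective α κ ν μ b := by
  have h0 := hp.alpha
  refine mul_le_mul_of_nonneg_left (Finset.sum_le_sum fun i _ => ?_) (by positivity)
  have h1 := hp.kappa i
  have h2 := hp.mu i
  have h3 := hp.nu i
  have h4 := ha i
  have h5 := hab i
  gcongr

theorem continuous_liftObjective (hp : PosParams α κ ν μ) :
    Continuous (liftObjective α κ ν μ) := by
  have h0 := hp.alpha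
  refine continuous_const.mul (continuous_finsetSum _ fun i _ => continuous_const.mul ?_)
  exact ((continuous_apply i).div_const _).rpow_const fun _ => Or.inr (by linarith)

theorem exists_bound_of_liftObjective_le (hp : PosParams α κ ν μ) (B : ℝ) :
    ∃ M > 0, ∀ n : I → ℝ, (∀ i, 0 ≤ n i) → liftObjective α κ ν μ n ≤ B → ∀ i, n i ≤ M := by
  have h0 := hp.alpha
  let D := fun i : I => (α + 1) * max B 0 / (ν i * κ i * μ i ^ (α - 1))
  obtain ⟨M, hM, h⟩ := exists_pos_forall_ge fun i => ν i * D i ^ (α + 1)⁻¹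
  refine ⟨M, hM, fun n hn hB i => le_trans ?_ (h i)⟩
  have h1 := hp.kappa i
  have h2 := hp.mu i
  have h3 := hp.nu i
  have hterm : ∀ i, 0 ≤ ν i * κ i * μ i ^ (α - 1) * (n i / ν i) ^ (α + 1) := fun i => by
    have h1 := hp.kappa i
    have h2 := hp.mu i
    have h3 := hp.nu i
    have h4 := hn i
    positivity
  have h5 : ν i * κ i * μ i ^ (α - 1) * (n i / ν i) ^ (α + 1) ≤ (α + 1) * max B 0 := by
    refine (Finset.single_le_sum (fun i _ => hterm i) (Finset.mem_univ i)).trans ?_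
    have h6 := hB.trans (le_max_left B 0)
    unfold liftObjective at h6
    rw [one_div, inv_mul_le_iff₀ (by positivity)] at h6
    exact h6
  have h7 : (n i / ν i) ^ (α + 1) ≤ D i := by
    rw [le_div_iff₀ (by positivity)]
    linarith
  have h8 := Real.rpow_le_rpow (Real.rpow_nonneg (div_nonneg (hn i) h3.le) _) h7
    (by positivity : (0 : ℝ) ≤ (α + 1)⁻¹)
  rw [Real.rpow_rpow_inv (div_nonneg (hn i) h3.le) (by positivity), div_le_iff₀ h3] at h8
  linarith

theorem exists_liftGradient_bound (hp : PosParams α κ ν μ) (M : ℝ) :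
    ∃ G > 0, ∀ n : I → ℝ, (∀ i, 0 ≤ n i) → (∀ i, n i ≤ M) → ∀ i, liftGradient α κ ν μ n i ≤ G := by
  obtain ⟨G, hG, h⟩ := exists_pos_forall_ge fun i : I => liftGradient α κ ν μ (fun _ => M) i
  refine ⟨G, hG, fun n hn hM i => le_trans ?_ (h i)⟩
  have h1 := hp.kappa i
  have h2 := hp.mu i
  have h3 := hp.nu i
  have h4 := hn i
  have h5 := hM i
  have h0 := hp.alpha
  unfold liftGradient
  gcongr

/-- The cost is Lipschitz on bounded sets, in the one-sided form that is needed. -/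
theorem exists_liftObjective_lipschitz (hp : PosParams α κ ν μ) (M : ℝ) :
    ∃ C > 0, ∀ a b : I → ℝ, (∀ i, 0 ≤ a i) → (∀ i, 0 ≤ b i) → (∀ i, b i ≤ M) →
      ∀ e : ℝ, 0 ≤ e → (∀ i, |b i - a i| ≤ e) →
        liftObjective α κ ν μ b ≤ liftObjective α κ ν μ a + C * e := by
  obtain ⟨G, hG, h⟩ := exists_liftGradient_bound (I := I) hp M
  refine ⟨(Fintype.card I + 1) * G, by positivity, fun a b ha hb hM e he0 he => ?_⟩
  have h1 := liftObjective_tangent_le hp ha hb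
  have h2 : ∑ i, liftGradient α κ ν μ b i * (b i - a i) ≤ ∑ _i : I, G * |e| := by
    refine Finset.sum_le_sum fun i _ => ?_
    refine mul_le_mul_of_nonneg (h b hb hM i) ?_ (liftGradient_nonneg hp hb i) (abs_nonneg e)
    exact (le_abs_self _).trans ((he i).trans (le_abs_self e))
  have h3 : ∑ i, liftGradient α κ ν μ b i * (a i - b i)
      = -∑ i, liftGradient α κ ν μ b i * (b i - a i) := by
    rw [← Finset.sum_neg_distrib]
    exact Finset.sum_congr rfl fun i _ => by ring
  rw [Finset.sum_const, Finset.card_univ, nsmul_eq_mul] at h2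
  rw [abs_of_nonneg he0] at h2
  nlinarith [mul_nonneg hG.le he0]

end Lift

/-! ### The lifting map -/

section LiftMap

variable {I J : Type*} [Fintype I] [Fintype J] [DecidableEq J]
variable {net : Network I J} {α : ℝ} {κ ν μ : I → ℝ}

theorem Network.A_nonneg (net : Network I J) (j : J) (i : I) : 0 ≤ net.A j i := by
  unfold Network.A incidence
  simp only [Matrix.of_apply]
  split_ifs <;> norm_num

theorem Network.A_le_one (net : Network I J) (j : J) (i : I) : net.A j i ≤ 1 := by
  unfold Network.A incidence
  simp only [Matrix.of_apply]
  split_ifs <;> norm_num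

theorem Network.A_eq_one {net : Network I J} {j : J} {i : I} (h : j ∈ net.route i) :
    net.A j i = 1 := by
  simp [Network.A, incidence, h]

theorem workload_add (n m : I → ℝ) (j : J) :
    workload net μ (n + m) j = workload net μ n j + workload net μ m j := by
  simp only [workload, Pi.add_apply, add_div, mul_add, Finset.sum_add_distrib]

theorem workload_smul (c : ℝ) (n : I → ℝ) : workload net μ (c • n) = c • workload net μ n := by
  funext j
  simp only [workload, Pi.smul_apply, smul_eq_mul, Finset.mul_sum]
  exact Finset.sum_congr rfl fun i _ => by ring

/-- Raising every coordinate by `e * β`, with `β` an upper bound for `μ`, raises every workload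
by at least `e`. -/
theorem le_workload_add_const (hμ : ∀ i, 0 < μ i) (hrow : ∀ j, ∃ i, j ∈ net.route i) {β : ℝ}
    (hβ : ∀ i, μ i ≤ β) (n : I → ℝ) {e : ℝ} (he : 0 ≤ e) (j : J) :
    workload net μ n j + e ≤ workload net μ (n + fun _ => e * β) j := by
  rw [workload_add]
  obtain ⟨i, hi⟩ := hrow j
  have hβ0 : 0 < β := (hμ i).trans_le (hβ i)
  have h : net.A j i * (e * β / μ i) ≤ workload net μ (fun _ => e * β) j :=
    Finset.single_le_sum (f := fun i => net.A j i * (e * β / μ i))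
      (fun i _ => mul_nonneg (net.A_nonneg j i)
        (div_nonneg (mul_nonneg he hβ0.le) (hμ i).le)) (Finset.mem_univ i)
  rw [Network.A_eq_one hi, one_mul] at h
  have h2 : e ≤ e * β / μ i := by
    rw [le_div_iff₀ (hμ i)]
    exact mul_le_mul_of_nonneg_left (hβ i) he
  linarith

theorem continuous_workload : Continuous (workload net μ) := by
  unfold workload
  fun_prop

theorem exists_isLift (hp : PosParams α κ ν μ) (hrow : ∀ j, ∃ i, j ∈ net.route i) (w : J → ℝ) :
    ∃ n, IsLift net α κ ν μ w n := by
  obtain ⟨β, hβ0, hβ⟩ := exists_pos_forall_ge μ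
  obtain ⟨e, he0, he⟩ := exists_pos_forall_ge w
  let n₀ : I → ℝ := fun _ => e * β
  have hn₀ : (∀ i, 0 ≤ n₀ i) ∧ ∀ j, w j ≤ workload net μ n₀ j := by
    refine ⟨fun i => by positivity, fun j => (he j).trans ?_⟩
    have h := le_workload_add_const hp.mu hrow hβ 0 he0.le j
    have h0 : workload net μ 0 j = 0 := by simp [workload]
    rw [h0, zero_add, zero_add] at h
    exact h
  obtain ⟨M, hM0, hM⟩ := exists_bound_of_liftObjective_le hp (liftObjective α κ ν μ n₀)
  let K : Set (I → ℝ) := Set.Icc 0 (fun _ => M) ∩ {n | w ≤ workload net μ n}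
  have hK : IsCompact K := isCompact_Icc.inter_right
    (isClosed_le continuous_const continuous_workload)
  obtain ⟨n, hn, hmin⟩ := hK.exists_isMinOn
    ⟨n₀, ⟨⟨hn₀.1, hM n₀ hn₀.1 le_rfl⟩, hn₀.2⟩⟩ (continuous_liftObjective hp).continuousOn
  refine ⟨n, ⟨hn.1.1, hn.2⟩, fun m hm => ?_⟩
  by_cases h : liftObjective α κ ν μ m ≤ liftObjective α κ ν μ n₀
  · exact hmin ⟨⟨hm.1, hM m hm.1 h⟩, hm.2⟩
  · have h1 : liftObjective α κ ν μ n ≤ liftObjective α κ ν μ n₀ :=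
      hmin ⟨⟨hn₀.1, hM n₀ hn₀.1 le_rfl⟩, hn₀.2⟩
    linarith

theorem isLift_lift (hp : PosParams α κ ν μ) (hrow : ∀ j, ∃ i, j ∈ net.route i) (w : J → ℝ) :
    IsLift net α κ ν μ w (lift net α κ ν μ w) :=
  Classical.epsilon_spec (exists_isLift hp hrow w)

/-- Near-minimizers of the lifting problem are close to the minimizer, uniformly over bounded
sets. The midpoint of two feasible vectors is feasible, so this is uniform strict convexity. -/
theorem exists_near_of_near_optimal (hp : PosParams α κ ν μ) (M ε : ℝ) (hε : 0 < ε) :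
    ∃ δ > 0, ∀ (w : J → ℝ) (n m : I → ℝ), IsLift net α κ ν μ w n → (∀ i, 0 ≤ m i) →
      (∀ j, w j ≤ workload net μ m j) → (∀ i, m i ≤ M) →
      liftObjective α κ ν μ m < liftObjective α κ ν μ n + δ → ∀ i, |m i - n i| < ε := by
  have h0 := hp.alpha
  -- the minimizer is bounded because its cost is at most that of `m`
  obtain ⟨M₁, hM₁0, hM₁⟩ := exists_bound_of_liftObjective_le hp
    (liftObjective α κ ν μ fun _ => M)
  let M₂ := max M M₁
  let c : I → ℝ := fun i => 1 / (α + 1) * (ν i * κ i * μ i ^ (α - 1))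
  have hc : ∀ i, 0 < c i := fun i => by
    have h1 := hp.kappa i
    have h2 := hp.mu i
    have h3 := hp.nu i
    positivity
  have hgap := fun i : I => exists_rpow_midpoint_gap (p := α + 1) (by linarith) (M₂ / ν i)
    (ε / ν i) (div_pos hε (hp.nu i))
  choose d hd hgap using hgap
  obtain ⟨δ, hδ, hδd⟩ := exists_pos_forall_le (fun i => c i * d i) fun i => mul_pos (hc i) (hd i)
  refine ⟨δ, hδ, fun w n m hn hm0 hmw hmM hlt i => ?_⟩
  by_contra! hcon
  have hle : liftObjective α κ ν μ n ≤ liftObjective α κ ν μ m := hn.2 m ⟨hm0, hmw⟩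
  have hnM : ∀ i, n i ≤ M₂ := fun i =>
    (hM₁ n hn.1.1 (hle.trans (liftObjective_mono hp hm0 hmM)) i).trans (le_max_right _ _)
  have hmM₂ : ∀ i, m i ≤ M₂ := fun i => (hmM i).trans (le_max_left _ _)
  let q : I → ℝ := fun i => (m i + n i) / 2
  have hq : liftObjective α κ ν μ n ≤ liftObjective α κ ν μ q := by
    refine hn.2 q ⟨fun i => by have := hm0 i; have := hn.1.1 i; simp only [q]; positivity,
      fun j => ?_⟩
    have h1 : q = (1 / 2 : ℝ) • (m + n) := by
      funext i
      simp only [q, Pi.smul_apply, Pi.add_apply, smul_eq_mul]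
      ring
    rw [h1, workload_smul, Pi.smul_apply, workload_add, smul_eq_mul]
    have := hmw j
    have := hn.1.2 j
    linarith
  have hbr : ∀ i, 0 ≤ (m i / ν i) ^ (α + 1) + (n i / ν i) ^ (α + 1)
      - 2 * (q i / ν i) ^ (α + 1) := fun i => by
    have h := rpow_midpoint_le (p := α + 1) (by linarith) (div_nonneg (hm0 i) (hp.nu i).le)
      (div_nonneg (hn.1.1 i) (hp.nu i).le)
    rw [show (m i / ν i + n i / ν i) / 2 = q i / ν i by simp only [q]; ring] at h
    linarith
  have hsum : liftObjective α κ ν μ m + liftObjective α κ ν μ n - 2 * liftObjective α κ ν μ q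
      = ∑ i, c i * ((m i / ν i) ^ (α + 1) + (n i / ν i) ^ (α + 1)
        - 2 * (q i / ν i) ^ (α + 1)) := by
    simp only [liftObjective, Finset.mul_sum, ← Finset.sum_add_distrib, ← Finset.sum_sub_distrib]
    exact Finset.sum_congr rfl fun i _ => by simp only [c]; ring
  have hsing := Finset.single_le_sum (fun i _ => mul_nonneg (hc i).le (hbr i)) (Finset.mem_univ i)
  rw [← hsum] at hsing
  have hν := hp.nu i
  have h2 := hgap i (m i / ν i) (n i / ν i) (div_nonneg (hm0 i) hν.le)
    (div_le_div_of_nonneg_right (hmM₂ i) hν.le) (div_nonneg (hn.1.1 i) hν.le)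
    (div_le_div_of_nonneg_right (hnM i) hν.le) (by
      rw [← sub_div, abs_div, abs_of_pos hν]
      exact div_le_div_of_nonneg_right hcon hν.le)
  rw [show (m i / ν i + n i / ν i) / 2 = q i / ν i by simp only [q]; ring] at h2
  have h3 := mul_le_mul_of_nonneg_left h2 (hc i).le
  have h4 := hδd i
  linarith

theorem IsLift.unique (hp : PosParams α κ ν μ) {w : J → ℝ} {n m : I → ℝ}
    (hn : IsLift net α κ ν μ w n) (hm : IsLift net α κ ν μ w m) : m = n := by
  funext i
  refine sub_eq_zero.1 (abs_nonpos_iff.1 (le_of_forall_pos_lt_add fun ε hε => ?_))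
  obtain ⟨M, -, hM⟩ := exists_pos_forall_ge m
  obtain ⟨δ, hδ, h⟩ := exists_near_of_near_optimal (net := net) hp M ε hε
  rw [zero_add]
  exact h w n m hn hm.1.1 hm.1.2 hM (by have := hm.2 n hn.1; linarith) i

theorem liftObjective_smul (hp : PosParams α κ ν μ) {c : ℝ} (hc : 0 < c) {n : I → ℝ}
    (hn : ∀ i, 0 ≤ n i) :
    liftObjective α κ ν μ (c • n) = c ^ (α + 1) * liftObjective α κ ν μ n := by
  simp only [liftObjective, Finset.mul_sum]
  refine Finset.sum_congr rfl fun i _ => ?_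
  rw [Pi.smul_apply, smul_eq_mul, mul_div_assoc, Real.mul_rpow hc.le
    (div_nonneg (hn i) (hp.nu i).le)]
  ring

theorem lift_smul (hp : PosParams α κ ν μ) (hrow : ∀ j, ∃ i, j ∈ net.route i) {c : ℝ} (hc : 0 < c)
    (w : J → ℝ) : lift net α κ ν μ (c • w) = c • lift net α κ ν μ w := by
  have h := isLift_lift hp hrow w
  refine IsLift.unique hp ⟨⟨fun i => mul_nonneg hc.le (h.1.1 i), fun j => ?_⟩, fun m hm => ?_⟩
    (isLift_lift hp hrow (c • w))
  · rw [workload_smul]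
    exact mul_le_mul_of_nonneg_left (h.1.2 j) hc.le
  · have hm' : ∀ i, 0 ≤ (c⁻¹ • m) i := fun i => mul_nonneg (inv_nonneg.2 hc.le) (hm.1 i)
    have h1 := h.2 (c⁻¹ • m) ⟨hm', fun j => by
      rw [workload_smul, Pi.smul_apply, smul_eq_mul, inv_mul_eq_div, le_div_iff₀ hc, mul_comm]
      exact hm.2 j⟩
    have h2 := liftObjective_smul hp hc hm'
    rw [smul_inv_smul₀ hc.ne'] at h2
    rw [liftObjective_smul hp hc h.1.1, h2]
    exact mul_le_mul_of_nonneg_left h1 (Real.rpow_nonneg hc.le _)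

/-- The optimal cost of the lifting problem is monotone and Lipschitz in the workload. -/
theorem exists_liftObjective_lift_le (hp : PosParams α κ ν μ)
    (hrow : ∀ j, ∃ i, j ∈ net.route i) (B : ℝ) :
    ∃ C > 0, ∀ (w w' : J → ℝ) (e : ℝ), 0 ≤ e → e ≤ 1 → (∀ j, w j - e ≤ w' j) →
      liftObjective α κ ν μ (lift net α κ ν μ w') ≤ B →
      liftObjective α κ ν μ (lift net α κ ν μ w)
        ≤ liftObjective α κ ν μ (lift net α κ ν μ w') + C * e := by
  obtain ⟨β, hβ0, hβ⟩ := exists_pos_forall_ge μ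
  obtain ⟨M, hM0, hM⟩ := exists_bound_of_liftObjective_le hp B
  obtain ⟨C, hC0, hC⟩ := exists_liftObjective_lipschitz hp (M + β)
  refine ⟨C * β, by positivity, fun w w' e he he1 hw hB => ?_⟩
  have h' := isLift_lift hp hrow w'
  set n := lift net α κ ν μ w'
  have heβ : 0 ≤ e * β := by positivity
  have h1 : liftObjective α κ ν μ (lift net α κ ν μ w)
      ≤ liftObjective α κ ν μ (n + fun _ => e * β) := by
    refine (isLift_lift hp hrow w).2 _ ⟨fun i => add_nonneg (h'.1.1 i) heβ, fun j => ?_⟩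
    have := le_workload_add_const hp.mu hrow hβ n he j
    have := h'.1.2 j
    have := hw j
    linarith
  refine h1.trans ((hC n _ h'.1.1 (fun i => add_nonneg (h'.1.1 i) heβ) (fun i => ?_) (e * β) heβ
    fun i => ?_).trans (le_of_eq (by ring)))
  · have := hM n h'.1.1 hB i
    have : e * β ≤ β := mul_le_of_le_one_left hβ0.le he1
    show n i + e * β ≤ M + β
    linarith
  · simp [abs_of_nonneg heβ]

end LiftMap

/-! ### The Lyapunov function -/

section CostGap

variable {I J : Type*} [Fintype I] [Fintype J] [DecidableEq J]
variable {net : Network I J} {α : ℝ} {κ ν μ : I → ℝ}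

/-- The Lyapunov function: the excess of the cost of `n` over the least cost among the vectors
that have at least the workload of `n`. -/
noncomputable def costGap (net : Network I J) (α : ℝ) (κ ν μ n : I → ℝ) : ℝ :=
  liftObjective α κ ν μ n - liftObjective α κ ν μ (lift net α κ ν μ (workload net μ n))

theorem liftObjective_lift_workload_le (hp : PosParams α κ ν μ)
    (hrow : ∀ j, ∃ i, j ∈ net.route i) {n : I → ℝ} (hn : ∀ i, 0 ≤ n i) :
    liftObjective α κ ν μ (lift net α κ ν μ (workload net μ n)) ≤ liftObjective α κ ν μ n :=
  (isLift_lift hp hrow _).2 n ⟨hn, fun _ => le_rfl⟩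

theorem eventually_workload_near (hμ : ∀ i, 0 < μ i) {e : ℝ} (he : 0 < e) :
    ∀ᶠ μ' in 𝓝 μ, ∀ n : I → ℝ, (∀ i, 0 ≤ n i) → (∀ i, n i ≤ 1) →
      ∀ j, |workload net μ' n j - workload net μ n j| ≤ e := by
  have hc : ContinuousAt (fun μ' : I → ℝ => ∑ i, |(μ' i)⁻¹ - (μ i)⁻¹|) μ := by
    refine tendsto_finsetSum _ fun i _ => ?_
    exact (((continuousAt_apply i μ).inv₀ (hμ i).ne').sub continuousAt_const).abs
  have h0 : ∀ᶠ μ' in 𝓝 μ, ∑ i, |(μ' i)⁻¹ - (μ i)⁻¹| < e :=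
    hc.eventually_lt continuousAt_const (by simpa using he)
  filter_upwards [h0] with μ' h n hn hn1 j
  rw [workload, workload, ← Finset.sum_sub_distrib]
  refine (Finset.abs_sum_le_sum_abs _ _).trans ((Finset.sum_le_sum fun i _ => ?_).trans h.le)
  rw [show net.A j i * (n i / μ' i) - net.A j i * (n i / μ i)
    = (net.A j i * n i) * ((μ' i)⁻¹ - (μ i)⁻¹) by ring, abs_mul,
    abs_of_nonneg (mul_nonneg (net.A_nonneg j i) (hn i))]
  exact mul_le_of_le_one_left (abs_nonneg _)
    (mul_le_one₀ (net.A_le_one j i) (hn i) (hn1 i))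

/-- A small Lyapunov function forces `n` to be close to the lift of its workload, even if the
workload is computed with a slightly perturbed `μ'`. -/
theorem exists_near_lift_of_costGap_le (hp : PosParams α κ ν μ)
    (hrow : ∀ j, ∃ i, j ∈ net.route i) {ε : ℝ} (hε : 0 < ε) :
    ∃ δ > 0, ∀ᶠ μ' in 𝓝 μ, ∀ n : I → ℝ, (∀ i, 0 ≤ n i) → (∀ i, n i ≤ 1) →
      costGap net α κ ν μ n ≤ δ →
      ∀ i, |n i - lift net α κ ν μ (workload net μ' n) i| ≤ ε := by
  obtain ⟨β, hβ0, hβ⟩ := exists_pos_forall_ge μ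
  obtain ⟨δ, hδ, hnear⟩ := exists_near_of_near_optimal (net := net) hp (1 + β) (ε / 2) (half_pos hε)
  obtain ⟨C₁, hC₁, h₁⟩ := exists_liftObjective_lift_le (net := net) hp hrow
    (liftObjective α κ ν μ fun _ => 1 + β)
  obtain ⟨C₂, hC₂, h₂⟩ := exists_liftObjective_lipschitz hp (1 + β)
  -- `e` bounds the change of the workload; `n + e * β` is feasible for the perturbed workload
  obtain ⟨e, he0, he⟩ : ∃ e > 0, e ≤ 1 ∧ e * β ≤ ε / 2 ∧ C₂ * (e * β) ≤ δ / 4 ∧ C₁ * e ≤ δ / 4 := by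
    refine ⟨min 1 (min (ε / 2 / β) (min (δ / 4 / (C₂ * β)) (δ / 4 / C₁))), by positivity,
      min_le_left _ _, ?_, ?_, ?_⟩
    · rw [← le_div_iff₀ hβ0]
      exact (min_le_right _ _).trans (min_le_left _ _)
    · rw [mul_left_comm, ← le_div_iff₀ (by positivity)]
      exact (min_le_right _ _).trans ((min_le_right _ _).trans (min_le_left _ _))
    · rw [mul_comm, ← le_div_iff₀ hC₁]
      exact (min_le_right _ _).trans ((min_le_right _ _).trans (min_le_right _ _))
  obtain ⟨he1, heε, heδ, heδ'⟩ := he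
  refine ⟨δ / 4, by positivity, ?_⟩
  filter_upwards [eventually_workload_near (net := net) hp.mu he0] with μ' hμ' n hn hn1 hgap i
  have heβ : 0 ≤ e * β := by positivity
  have heβ1 : e * β ≤ β := mul_le_of_le_one_left hβ0.le he1
  set w := workload net μ n
  set w' := workload net μ' n
  have hL := isLift_lift hp hrow w
  have hL' := isLift_lift hp hrow w'
  set m : I → ℝ := n + fun _ => e * β
  have hm0 : ∀ i, 0 ≤ m i := fun i => add_nonneg (hn i) heβ
  have hmM : ∀ i, m i ≤ 1 + β := fun i => add_le_add (hn1 i) heβ1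
  have hmw : ∀ j, w' j ≤ workload net μ m j := fun j => by
    have h1 := le_workload_add_const hp.mu hrow hβ n he0.le j
    have h2 := (abs_le.1 (hμ' n hn hn1 j)).2
    linarith
  have hB : liftObjective α κ ν μ (lift net α κ ν μ w') ≤ liftObjective α κ ν μ fun _ => 1 + β :=
    (hL'.2 m ⟨hm0, hmw⟩).trans (liftObjective_mono hp hm0 hmM)
  have h3 := h₁ w w' e he0.le he1 (fun j => by have := (abs_le.1 (hμ' n hn hn1 j)).1; linarith) hB
  have h4 := h₂ n m hn hm0 hmM (e * β) heβ (fun i => by simp [m, abs_of_nonneg heβ])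
  have h5 := hnear w' _ m hL' hm0 hmw hmM (by unfold costGap at hgap; linarith) i
  have h6 : n i = m i - e * β := by simp [m]
  rw [h6]
  rw [abs_lt] at h5
  rw [abs_le]
  constructor <;> linarith [h5.1, h5.2]

/-- Conversely, the Lyapunov function is small near the lift of the (perturbed) workload. -/
theorem exists_costGap_le_of_near_lift (hp : PosParams α κ ν μ)
    (hrow : ∀ j, ∃ i, j ∈ net.route i) {ε : ℝ} (hε : 0 < ε) :
    ∃ δ > 0, ∀ᶠ μ' in 𝓝 μ, ∀ n : I → ℝ, (∀ i, 0 ≤ n i) → (∀ i, n i ≤ 1) →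
      (∀ i, |n i - lift net α κ ν μ (workload net μ' n) i| ≤ δ) →
      costGap net α κ ν μ n ≤ ε := by
  obtain ⟨C₁, hC₁, h₁⟩ := exists_liftObjective_lift_le (net := net) hp hrow
    (liftObjective α κ ν μ fun _ => 1)
  obtain ⟨C₂, hC₂, h₂⟩ := exists_liftObjective_lipschitz hp (1 : ℝ) (I := I)
  refine ⟨ε / 2 / C₂, by positivity, ?_⟩
  filter_upwards [eventually_workload_near (net := net) hp.mu
    (show 0 < min 1 (ε / 2 / C₁) by positivity)] with μ' hμ' n hn hn1 hnear
  have hB := (liftObjective_lift_workload_le hp hrow hn).trans (liftObjective_mono hp hn hn1)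
  have h3 := h₁ (workload net μ' n) (workload net μ n) _ (by positivity)
    (min_le_left 1 (ε / 2 / C₁))
    (fun j => by have := (abs_le.1 (hμ' n hn hn1 j)).2; linarith) hB
  have h4 := h₂ (lift net α κ ν μ (workload net μ' n)) n (isLift_lift hp hrow _).1.1 hn hn1 _
    (by positivity) hnear
  have h5 : C₁ * min 1 (ε / 2 / C₁) ≤ ε / 2 := by
    rw [mul_comm, ← le_div_iff₀ hC₁]
    exact min_le_right _ _
  rw [mul_div_cancel₀ _ hC₂.ne'] at h4
  unfold costGap
  linarith

end CostGap

/-! ### Fair allocations -/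

/-- The utility function whose weighted sum a fair allocation maximizes. -/
noncomputable def utility (α x : ℝ) : ℝ := if α = 1 then Real.log x else x ^ (1 - α) / (1 - α)

/-- The tangent inequality of the concave function `utility α`. -/
theorem utility_le {α : ℝ} (hα : 0 < α) {x y : ℝ} (hx : 0 < x) (hy : 0 ≤ y)
    (hy' : 1 ≤ α → 0 < y) : utility α y ≤ utility α x + x ^ (-α) * (y - x) := by
  unfold utility
  have hxα := Real.rpow_pos_of_pos hx α
  have hs : y / x = 1 + (y / x - 1) := by ring
  have hyx : y ^ (1 - α) = x * x ^ (-α) * (y / x) ^ (1 - α) := by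
    rw [Real.div_rpow hy hx.le, Real.rpow_sub hx, Real.rpow_one, Real.rpow_neg hx.le]
    field_simp
  have hxx : x ^ (1 - α) = x * x ^ (-α) := by
    rw [Real.rpow_sub hx, Real.rpow_one, Real.rpow_neg hx.le, div_eq_mul_inv]
  have hc : 0 < x * x ^ (-α) := mul_pos hx (Real.rpow_pos_of_pos hx _)
  split_ifs with h1
  · subst h1
    have hy0 := hy' le_rfl
    have h := Real.log_le_sub_one_of_pos (div_pos hy0 hx)
    rw [Real.log_div hy0.ne' hx.ne'] at h
    rw [Real.rpow_neg_one, inv_mul_eq_div, sub_div, div_self hx.ne']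
    linarith
  · have hgoal : x * x ^ (-α) / (1 - α) + x ^ (-α) * (y - x)
        = x * x ^ (-α) * (1 + (1 - α) * (y / x - 1)) / (1 - α) := by
      have : 1 - α ≠ 0 := sub_ne_zero.2 (Ne.symm h1)
      field_simp
    rw [hxx, hyx, hgoal]
    rcases lt_or_gt_of_ne h1 with h | h
    · have hB := rpow_one_add_le_one_add_mul_self (s := y / x - 1) (p := 1 - α)
        (by have := div_nonneg hy hx.le; linarith) (by linarith) (by linarith)
      rw [← hs] at hB
      exact div_le_div_of_nonneg_right (mul_le_mul_of_nonneg_left hB hc.le) (by linarith)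
    · have ht : 0 < y / x := div_pos (hy' h.le) hx
      have hB : 1 + (1 - α) * (y / x - 1) ≤ (y / x) ^ (1 - α) := by
        have h2 := Real.add_one_le_exp (Real.log (y / x) * (1 - α))
        rw [Real.rpow_def_of_pos ht]
        have h3 := Real.log_le_sub_one_of_pos ht
        nlinarith
      exact div_le_div_of_nonpos_of_le (by linarith) (mul_le_mul_of_nonneg_left hB hc.le)

/-- `exp (c * utility α x)`, set to `0` at `x = 0` if the utility tends to `-∞` there. -/
noncomputable def expUtility (α c x : ℝ) : ℝ :=
  if 1 ≤ α ∧ x = 0 then 0 else Real.exp (c * utility α x)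

theorem tendsto_utility_atBot {α : ℝ} (hα : 1 ≤ α) :
    Tendsto (utility α) (𝓝[>] 0) atBot := by
  rcases hα.eq_or_lt with rfl | h
  · have : utility 1 = Real.log := by funext x; simp [utility]
    rw [this]
    exact Real.tendsto_log_nhdsGT_zero
  · have : utility α = fun x => x ^ (1 - α) / (1 - α) := by
      funext x
      simp [utility, h.ne']
    rw [this]
    have h2 := tendsto_rpow_neg_nhdsGT_zero (y := 1 - α) (by linarith)
    exact h2.atTop_div_const_of_neg (by linarith)

theorem continuousOn_expUtility {α c : ℝ} (hc : 0 < c) :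
    ContinuousOn (expUtility α c) (Set.Ici 0) := by
  intro x hx
  by_cases hα : 1 ≤ α
  · have hpos : ∀ y : ℝ, 0 < y → expUtility α c y = Real.exp (c * utility α y) := fun y hy => by
      simp [expUtility, hy.ne']
    rcases (Set.mem_Ici.1 hx).eq_or_lt with rfl | hx'
    · rw [← Set.Ioi_union_left, continuousWithinAt_union]
      refine ⟨?_, continuousWithinAt_singleton⟩
      have h0 : expUtility α c 0 = 0 := by simp [expUtility, hα]
      rw [ContinuousWithinAt, h0]
      refine Tendsto.congr' (f₁ := fun y => Real.exp (c * utility α y)) ?_ ?_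
      · filter_upwards [self_mem_nhdsWithin] with y hy
        exact (hpos y hy).symm
      · exact Real.tendsto_exp_atBot.comp ((tendsto_utility_atBot hα).const_mul_atBot hc)
    · refine ContinuousAt.continuousWithinAt ?_
      have h1 : ContinuousAt (utility α) x := by
        unfold utility
        split_ifs
        · exact Real.continuousAt_log hx'.ne'
        · exact (Real.continuousAt_rpow_const x _ (Or.inl hx'.ne')).div_const _
      refine ContinuousAt.congr (f := fun y => Real.exp (c * utility α y)) (by fun_prop) ?_
      filter_upwards [lt_mem_nhds hx'] with y hy
      exact (hpos y hy).symm
  · have h1 : expUtility α c = fun y => Real.exp (c * (y ^ (1 - α) / (1 - α))) := by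
      funext y
      have : α ≠ 1 := fun h => hα h.ge
      simp [expUtility, hα, utility, this]
    rw [h1]
    have h2 : Continuous fun y : ℝ => y ^ (1 - α) :=
      continuous_id.rpow_const fun _ => Or.inr (by linarith)
    exact (by fun_prop : Continuous fun y : ℝ =>
      Real.exp (c * (y ^ (1 - α) / (1 - α)))).continuousWithinAt

section Allocation

variable {I J : Type*} [Fintype I] [Fintype J] [DecidableEq J]
variable {net : Network I J} {α : ℝ} {κ n : I → ℝ}

theorem fairObjective_eq_bot (x : I → ℝ) (h : 1 ≤ α ∧ ∃ i, 0 < n i ∧ x i = 0) :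
    fairObjective α κ n x = ⊥ := by
  simp [fairObjective, h]

theorem fairObjective_eq_coe (x : I → ℝ) (h : ¬ (1 ≤ α ∧ ∃ i, 0 < n i ∧ x i = 0)) :
    fairObjective α κ n x = ((∑ i with 0 < n i, κ i * n i ^ α * utility α (x i) : ℝ) : EReal) := by
  unfold fairObjective
  rw [if_neg h]
  by_cases h1 : α = 1
  · subst h1
    simp [utility]
  · simp only [h1, if_false, utility]

theorem IsFeasible.sum_le (hn : ∀ i, 0 ≤ n i) {x : I → ℝ} (hx : IsFeasible net n x) (j : J) :
    ∑ i, net.A j i * x i ≤ net.capacity j := by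
  refine le_trans (le_of_eq ?_) (hx.2.2 j)
  symm
  refine Finset.sum_subset (Finset.filter_subset _ _) fun i _ hi => ?_
  have h0 : n i = 0 := le_antisymm (by simpa using hi) (hn i)
  rw [hx.1 i h0, mul_zero]

theorem exists_allocation_bound (net : Network I J) :
    ∃ M > 0, ∀ x : I → ℝ, (∀ i, 0 ≤ x i) → (∀ j, ∑ i, net.A j i * x i ≤ net.capacity j) →
      ∀ i, x i ≤ M := by
  obtain ⟨M, hM, h⟩ := exists_pos_forall_ge net.capacity
  refine ⟨M, hM, fun x hx0 hx i => ?_⟩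
  obtain ⟨j, hj⟩ := net.route_nonempty i
  have h1 := Finset.single_le_sum (f := fun i => net.A j i * x i)
    (fun i _ => mul_nonneg (net.A_nonneg j i) (hx0 i)) (Finset.mem_univ i)
  simp only [Network.A_eq_one hj, one_mul] at h1
  exact h1.trans ((hx j).trans (h j))

/-- The exponential of the objective is continuous up to the boundary of the feasible set, so it
attains its maximum there; the maximum is positive, hence the maximizer has finite objective. -/
theorem exists_isFairAllocation (hκ : ∀ i, 0 < κ i) (hn : ∀ i, 0 ≤ n i) :
    ∃ x, IsFairAllocation net α κ n x := by
  obtain ⟨M, hM0, hM⟩ := exists_allocation_bound net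
  have hK : IsCompact {x | IsFeasible net n x} := by
    have h1 : {x | IsFeasible net n x} = Set.Icc 0 (fun _ => M) ∩ {x | IsFeasible net n x} :=
      Set.right_eq_inter.2 fun x hx => ⟨hx.2.1, hM x hx.2.1 (hx.sum_le hn)⟩
    rw [h1]
    refine isCompact_Icc.inter_right ?_
    have h2 : {x | IsFeasible net n x} = (⋂ i, {x : I → ℝ | n i = 0 → x i = 0}) ∩
        ({x : I → ℝ | 0 ≤ x} ∩
          ⋂ j, {x : I → ℝ | ∑ i with 0 < n i, net.A j i * x i ≤ net.capacity j}) := by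
      ext x
      simp [IsFeasible, Pi.le_def]
    rw [h2]
    refine (isClosed_iInter fun i => ?_).inter ((isClosed_le continuous_const continuous_id).inter
      (isClosed_iInter fun j => isClosed_le (by fun_prop) continuous_const))
    by_cases h : n i = 0
    · simpa [h] using isClosed_eq (continuous_apply i) continuous_const
    · simp [h]
  obtain ⟨c, hc0, hc⟩ := exists_pos_forall_le net.capacity net.capacity_pos
  let y : I → ℝ := fun i => if n i = 0 then 0 else c / (Fintype.card I + 1)
  have hy0 : ∀ i, 0 ≤ y i := fun i => by simp only [y]; split_ifs <;> positivity
  have hy : IsFeasible net n y := by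
    refine ⟨fun i hi => by simp [y, hi], hy0, fun j => le_trans ?_ (hc j)⟩
    calc ∑ i with 0 < n i, net.A j i * y i ≤ ∑ i, net.A j i * y i :=
          Finset.sum_le_sum_of_subset_of_nonneg (Finset.filter_subset _ _)
            fun i _ _ => mul_nonneg (net.A_nonneg j i) (hy0 i)
      _ ≤ ∑ _i : I, c / (Fintype.card I + 1) := by
          refine Finset.sum_le_sum fun i _ => ?_
          refine (mul_le_of_le_one_left (hy0 i) (net.A_le_one j i)).trans ?_
          simp only [y]
          split_ifs
          · positivity
          · exact le_rfl
      _ ≤ c := by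
          rw [Finset.sum_const, Finset.card_univ, nsmul_eq_mul, ← mul_div_assoc,
            div_le_iff₀ (by positivity)]
          nlinarith
  let w : I → ℝ := fun i => κ i * n i ^ α
  have hw : ∀ i, 0 < n i → 0 < w i := fun i hi => mul_pos (hκ i) (Real.rpow_pos_of_pos hi _)
  let Φ : (I → ℝ) → ℝ := fun x => ∏ i with 0 < n i, expUtility α (w i) (x i)
  have hΦ : ContinuousOn Φ {x | IsFeasible net n x} := by
    refine continuousOn_finsetProd _ fun i hi => ?_
    exact (continuousOn_expUtility (hw i (by simpa using hi))).comp
      (continuous_apply i).continuousOn fun x hx => hx.2.1 i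
  have hΦexp : ∀ x, ¬ (1 ≤ α ∧ ∃ i, 0 < n i ∧ x i = 0) →
      Φ x = Real.exp (∑ i with 0 < n i, κ i * n i ^ α * utility α (x i)) := fun x hx => by
    rw [Real.exp_sum]
    refine Finset.prod_congr rfl fun i hi => ?_
    have : ¬ (1 ≤ α ∧ x i = 0) := fun h => hx ⟨h.1, i, by simpa using hi, h.2⟩
    simp [expUtility, this, w]
  obtain ⟨x, hx, hmax⟩ := hK.exists_isMaxOn ⟨y, hy⟩ hΦ
  have hyne : ¬ (1 ≤ α ∧ ∃ i, 0 < n i ∧ y i = 0) := by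
    rintro ⟨-, i, hi, hyi⟩
    simp only [y, hi.ne', if_false] at hyi
    have : 0 < c / ((Fintype.card I : ℝ) + 1) := by positivity
    linarith
  have hxpos : 0 < Φ x := by
    have h1 : Φ y ≤ Φ x := hmax hy
    rw [hΦexp y hyne] at h1
    exact (Real.exp_pos _).trans_le h1
  have hxne : ¬ (1 ≤ α ∧ ∃ i, 0 < n i ∧ x i = 0) := by
    rintro ⟨h1, i, hi, hxi⟩
    refine hxpos.ne' (Finset.prod_eq_zero (i := i) (by simpa using hi) ?_)
    simp [expUtility, h1, hxi]
  refine ⟨x, hx, fun z hz => ?_⟩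
  by_cases hz0 : 1 ≤ α ∧ ∃ i, 0 < n i ∧ z i = 0
  · rw [fairObjective_eq_bot z hz0]
    exact bot_le
  · rw [fairObjective_eq_coe z hz0, fairObjective_eq_coe x hxne, EReal.coe_le_coe_iff]
    have h1 : Φ z ≤ Φ x := hmax hz
    rw [hΦexp z hz0, hΦexp x hxne] at h1
    exact Real.exp_le_exp.1 h1

/-- The properties of the allocation `x` in state `n` that drive the dynamics: it is feasible, and
it dominates, to first order around the reference allocation `ρ`, every positive allocation `z`
within the capacities. Unlike the definition of a fair allocation this is visibly invariant under
rescaling `n`. -/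
structure IsFairRate (net : Network I J) (α : ℝ) (κ ρ n x : I → ℝ) : Prop where
  nonneg : ∀ i, 0 ≤ x i
  capacity_le : ∀ j, ∑ i, net.A j i * x i ≤ net.capacity j
  dominates : ∀ z : I → ℝ, (∀ i, 0 < z i) → (∀ j, ∑ i, net.A j i * z i ≤ net.capacity j) →
    ∑ i, κ i * n i ^ α * (z i ^ (-α) * (z i - ρ i))
      ≤ ∑ i, κ i * n i ^ α * (ρ i ^ (-α) * (x i - ρ i))

theorem IsFairRate.smul {ρ x : I → ℝ} (h : IsFairRate net α κ ρ n x) (hn : ∀ i, 0 ≤ n i) {c : ℝ}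
    (hc : 0 ≤ c) : IsFairRate net α κ ρ (c • n) x := by
  refine ⟨h.nonneg, h.capacity_le, fun z hz hz' => ?_⟩
  have h1 := mul_le_mul_of_nonneg_left (h.dominates z hz hz') (Real.rpow_nonneg hc α)
  rw [Finset.mul_sum, Finset.mul_sum] at h1
  refine le_trans (le_of_eq ?_) (h1.trans (le_of_eq ?_)) <;>
  · refine Finset.sum_congr rfl fun i _ => ?_
    rw [Pi.smul_apply, smul_eq_mul, Real.mul_rpow hc (hn i)]
    ring

theorem isFairRate_allocation (hα : 0 < α) (hκ : ∀ i, 0 < κ i) (hn : ∀ i, 0 ≤ n i) {ρ : I → ℝ}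
    (hρ : ∀ i, 0 < ρ i) : IsFairRate net α κ ρ n (allocation net α κ n) := by
  obtain ⟨hfeas, hopt⟩ : IsFairAllocation net α κ n (allocation net α κ n) :=
    Classical.epsilon_spec (exists_isFairAllocation hκ hn)
  set x := allocation net α κ n
  refine ⟨hfeas.2.1, hfeas.sum_le hn, fun z hz hz' => ?_⟩
  let y : I → ℝ := fun i => if n i = 0 then 0 else z i
  have hyz : ∀ i, 0 < n i → y i = z i := fun i hi => by simp [y, hi.ne']
  have hy : IsFeasible net n y := by
    refine ⟨fun i hi => by simp [y, hi], fun i => ?_, fun j => le_trans ?_ (hz' j)⟩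
    · simp only [y]
      split_ifs
      exacts [le_rfl, (hz i).le]
    · rw [Finset.sum_congr rfl fun i hi => by rw [hyz i (by simpa using hi)]]
      exact Finset.sum_le_sum_of_subset_of_nonneg (Finset.filter_subset _ _)
        fun i _ _ => mul_nonneg (net.A_nonneg j i) (hz i).le
  have hyne : ¬ (1 ≤ α ∧ ∃ i, 0 < n i ∧ y i = 0) := by
    rintro ⟨-, i, hi, hyi⟩
    rw [hyz i hi] at hyi
    exact (hz i).ne' hyi
  have h1 := hopt y hy
  have hxne : ¬ (1 ≤ α ∧ ∃ i, 0 < n i ∧ x i = 0) := by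
    intro h
    rw [fairObjective_eq_bot x h, fairObjective_eq_coe y hyne] at h1
    exact (EReal.bot_lt_coe _).not_ge h1
  rw [fairObjective_eq_coe y hyne, fairObjective_eq_coe x hxne, EReal.coe_le_coe_iff] at h1
  have hsupp : ∀ f : I → ℝ, ∑ i with 0 < n i, κ i * n i ^ α * f i = ∑ i, κ i * n i ^ α * f i := by
    intro f
    refine Finset.sum_subset (Finset.filter_subset _ _) fun i _ hi => ?_
    have h0 : n i = 0 := le_antisymm (by simpa using hi) (hn i)
    rw [h0, Real.zero_rpow hα.ne', mul_zero, zero_mul]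
  rw [← hsupp, ← hsupp, ← sub_nonneg, ← Finset.sum_sub_distrib]
  rw [← sub_nonneg, ← Finset.sum_sub_distrib] at h1
  refine h1.trans (Finset.sum_le_sum fun i hi => ?_)
  have hi' : 0 < n i := by simpa using hi
  have hw : 0 ≤ κ i * n i ^ α := mul_nonneg (hκ i).le (Real.rpow_nonneg (hn i) _)
  have h2 := utility_le hα (hρ i) (hfeas.2.1 i)
    fun h => (hfeas.2.1 i).lt_of_ne fun h0 => hxne ⟨h, i, hi', h0.symm⟩
  have h3 := utility_le hα (hz i) (hρ i).le fun _ => hρ i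
  rw [hyz i hi', ← mul_sub, ← mul_sub]
  refine mul_le_mul_of_nonneg_left ?_ hw
  linarith

end Allocation

/-! ### The drift of the cost -/

section Drift

variable {I J : Type*} [Fintype I] [Fintype J] [DecidableEq J]
variable {net : Network I J} {α : ℝ} {κ ν μ : I → ℝ}

theorem drift_eq (hp : PosParams α κ ν μ) {a : I → ℝ} (ha : ∀ i, 0 ≤ a i) (x : I → ℝ) :
    ∑ i, liftGradient α κ ν μ a i * (ν i - μ i * x i)
      = -∑ i, κ i * a i ^ α * ((ν i / μ i) ^ (-α) * (x i - ν i / μ i)) := by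
  rw [← Finset.sum_neg_distrib]
  refine Finset.sum_congr rfl fun i _ => ?_
  rw [← mul_assoc, ← mul_liftGradient hp ha]
  have := (hp.mu i).ne'
  field_simp
  ring

/-- The drift of the cost, with gradient taken at `a` and the allocation at a nearby state `b`,
is controlled by any positive allocation `z` within the capacities. -/
theorem drift_le_of_isFairRate (hp : PosParams α κ ν μ) {a b x z : I → ℝ} {M d : ℝ}
    (ha : ∀ i, 0 ≤ a i) (hx : IsFairRate net α κ (fun i => ν i / μ i) b x) (hxM : ∀ i, x i ≤ M)
    (hab : ∀ i, |a i ^ α - b i ^ α| ≤ d)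
    (hz : ∀ i, 0 < z i) (hzC : ∀ j, ∑ i, net.A j i * z i ≤ net.capacity j) :
    ∑ i, liftGradient α κ ν μ a i * (ν i - μ i * x i)
      ≤ -(∑ i, κ i * a i ^ α * (z i ^ (-α) * (z i - ν i / μ i)))
        + d * ∑ i, κ i * ((ν i / μ i) ^ (-α) * (M + ν i / μ i)
          + z i ^ (-α) * |z i - ν i / μ i|) := by
  rw [drift_eq hp ha, Finset.mul_sum]
  have h := hx.dominates z hz hzC
  have hterm : ∀ i, κ i * b i ^ α * ((ν i / μ i) ^ (-α) * (x i - ν i / μ i))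
      - κ i * b i ^ α * (z i ^ (-α) * (z i - ν i / μ i))
      ≤ κ i * a i ^ α * ((ν i / μ i) ^ (-α) * (x i - ν i / μ i))
      - κ i * a i ^ α * (z i ^ (-α) * (z i - ν i / μ i))
      + d * (κ i * ((ν i / μ i) ^ (-α) * (M + ν i / μ i) + z i ^ (-α) * |z i - ν i / μ i|)) := by
    intro i
    have hρ : 0 < ν i / μ i := div_pos (hp.nu i) (hp.mu i)
    have h1 : |(ν i / μ i) ^ (-α) * (x i - ν i / μ i) - z i ^ (-α) * (z i - ν i / μ i)|
        ≤ (ν i / μ i) ^ (-α) * (M + ν i / μ i) + z i ^ (-α) * |z i - ν i / μ i| := by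
      refine (abs_sub _ _).trans (add_le_add ?_ ?_)
      · rw [abs_mul, abs_of_nonneg (Real.rpow_nonneg hρ.le _)]
        refine mul_le_mul_of_nonneg_left ?_ (Real.rpow_nonneg hρ.le _)
        rw [abs_le]
        have := hx.nonneg i
        have := hxM i
        constructor <;> linarith
      · rw [abs_mul, abs_of_nonneg (Real.rpow_nonneg (hz i).le _)]
    have h2 : (b i ^ α - a i ^ α) * ((ν i / μ i) ^ (-α) * (x i - ν i / μ i)
        - z i ^ (-α) * (z i - ν i / μ i)) ≤ d * ((ν i / μ i) ^ (-α) * (M + ν i / μ i)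
          + z i ^ (-α) * |z i - ν i / μ i|) := by
      refine (le_abs_self _).trans ?_
      rw [abs_mul, abs_sub_comm]
      exact mul_le_mul (hab i) h1 (abs_nonneg _) ((abs_nonneg _).trans (hab i))
    have h3 := mul_le_mul_of_nonneg_left h2 (hp.kappa i).le
    linarith
  have hsum := Finset.sum_le_sum fun i (_ : i ∈ Finset.univ) => hterm i
  rw [Finset.sum_add_distrib, Finset.sum_sub_distrib, Finset.sum_sub_distrib] at hsum
  linarith

/-- Away from the invariant states the drift of the cost is bounded away from zero. With
`v = (a - Δ(w(a))) / μ` the allocation `ρ + σ v` stays within the capacities, and the derivative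
of the fairness objective in the direction `v` is `∇F(a) · (a - Δ(w(a)))`, which is at least
`F(a) - F(Δ(w(a)))` because `F` is convex. -/
theorem exists_drift_le (hp : PosParams α κ ν μ) (hrow : ∀ j, ∃ i, j ∈ net.route i)
    (hcrit : ∀ j, ∑ i, net.A j i * (ν i / μ i) = net.capacity j) {δ : ℝ} (hδ : 0 < δ) :
    ∃ c > 0, ∃ η > 0, ∀ a b x : I → ℝ, (∀ i, 0 ≤ a i) → (∀ i, a i ≤ 1) → (∀ i, 0 ≤ b i) →
      (∀ i, b i ≤ 1) → (∀ i, |a i - b i| ≤ η) → δ ≤ costGap net α κ ν μ a →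
      IsFairRate net α κ (fun i => ν i / μ i) b x →
      ∑ i, liftGradient α κ ν μ a i * (ν i - μ i * x i) ≤ -c := by
  have hα := hp.alpha
  have hρ : ∀ i, 0 < ν i / μ i := fun i => div_pos (hp.nu i) (hp.mu i)
  obtain ⟨M, hM0, hM⟩ := exists_allocation_bound net
  obtain ⟨M₁, hM₁0, hM₁⟩ := exists_bound_of_liftObjective_le hp
    (liftObjective α κ ν μ fun _ => 1)
  obtain ⟨V, hV0, hV⟩ := exists_pos_forall_ge fun i => (1 + M₁) / μ i
  obtain ⟨k, hk0, hk⟩ := exists_pos_forall_ge fun _ : Unit => ∑ i, κ i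
  replace hk := hk ()
  -- `θ` bounds the variation of `x ^ (-α)` within distance `d` of `ρ`
  let θ : ℝ := δ / (2 * (k * V))
  have hθ : 0 < θ := by positivity
  have hcont : ∀ i, ∃ d > 0, ∀ z, |z - ν i / μ i| < d → |z ^ (-α) - (ν i / μ i) ^ (-α)| < θ :=
    fun i => Metric.continuousAt_iff.1
      (Real.continuousAt_rpow_const _ (-α) (Or.inl (hρ i).ne')) θ hθ
  choose d₀ hd₀ hd₀' using hcont
  obtain ⟨d, hd, hdle⟩ := exists_pos_forall_le (fun i => min (d₀ i) (ν i / μ i))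
    fun i => lt_min (hd₀ i) (hρ i)
  let σ : ℝ := d / (2 * V)
  have hσ : 0 < σ := by positivity
  have hσV : σ * V < d := by
    have : σ * V = d / 2 := by simp only [σ]; field_simp
    linarith
  obtain ⟨D, hD0, hD⟩ := exists_pos_forall_ge fun _ : Unit =>
    ∑ i, κ i * ((ν i / μ i) ^ (-α) * (M + ν i / μ i) + ((ν i / μ i) ^ (-α) + θ) * d)
  replace hD := hD ()
  obtain ⟨η, hη, hmod⟩ := exists_rpow_modulus hα 1 (σ * δ / (4 * D)) (by positivity)
  refine ⟨σ * δ / 4, by positivity, η, hη, fun a b x ha ha1 hb hb1 hab hgap hx => ?_⟩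
  have hL := isLift_lift hp hrow (workload net μ a)
  have hcost : liftObjective α κ ν μ a - liftObjective α κ ν μ (lift net α κ ν μ
    (workload net μ a)) ≥ δ := hgap
  have hLcost := liftObjective_lift_workload_le hp hrow ha
  set m := lift net α κ ν μ (workload net μ a)
  have hm1 : ∀ i, m i ≤ M₁ := hM₁ m hL.1.1 (hLcost.trans (liftObjective_mono hp ha ha1))
  let v : I → ℝ := fun i => (a i - m i) / μ i
  have hv : ∀ i, |v i| ≤ V := fun i => by
    refine le_trans ?_ (hV i)
    rw [abs_div, abs_of_pos (hp.mu i)]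
    refine div_le_div_of_nonneg_right ?_ (hp.mu i).le
    have := ha i
    have := ha1 i
    have := hL.1.1 i
    have := hm1 i
    rw [abs_le]
    constructor <;> linarith
  have hσv : ∀ i, |σ * v i| < d := fun i => by
    rw [abs_mul, abs_of_pos hσ]
    exact (mul_le_mul_of_nonneg_left (hv i) hσ.le).trans_lt hσV
  let z : I → ℝ := fun i => ν i / μ i + σ * v i
  have hz : ∀ i, 0 < z i := fun i => by
    have h1 := (abs_lt.1 (hσv i)).1
    have h2 := (hdle i).trans (min_le_right _ _)
    simp only [z]
    linarith
  have hzρ : ∀ i, z i - ν i / μ i = σ * v i := fun i => by simp only [z]; ring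
  have hzθ : ∀ i, |z i ^ (-α) - (ν i / μ i) ^ (-α)| ≤ θ := fun i =>
    (hd₀' i _ (by rw [hzρ]; exact (hσv i).trans_le ((hdle i).trans (min_le_left _ _)))).le
  have hzC : ∀ j, ∑ i, net.A j i * z i ≤ net.capacity j := fun j => by
    have h1 : ∑ i, net.A j i * z i
        = net.capacity j + σ * (workload net μ a j - workload net μ m j) := by
      rw [← hcrit j, workload, workload, ← Finset.sum_sub_distrib, Finset.mul_sum,
        ← Finset.sum_add_distrib]
      exact Finset.sum_congr rfl fun i _ => by simp only [z, v]; ring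
    have h2 := hL.1.2 j
    nlinarith
  have hd := drift_le_of_isFairRate hp ha hx (hM x hx.nonneg hx.capacity_le)
    (fun i => hmod (a i) (b i) (ha i) (ha1 i) (hb i) (hb1 i) (hab i)) hz hzC
  -- the error from freezing the gradient at `a`
  have herr : σ * δ / (4 * D) * ∑ i, κ i * ((ν i / μ i) ^ (-α) * (M + ν i / μ i)
      + z i ^ (-α) * |z i - ν i / μ i|) ≤ σ * δ / 4 := by
    have h1 : ∑ i, κ i * ((ν i / μ i) ^ (-α) * (M + ν i / μ i)
        + z i ^ (-α) * |z i - ν i / μ i|) ≤ D := by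
      refine (Finset.sum_le_sum fun i _ => ?_).trans hD
      refine mul_le_mul_of_nonneg_left (add_le_add le_rfl ?_) (hp.kappa i).le
      refine mul_le_mul ?_ (by rw [hzρ]; exact (hσv i).le) (abs_nonneg _) ?_
      · have := (abs_le.1 (hzθ i)).2
        linarith
      · have := Real.rpow_nonneg (hρ i).le (-α)
        linarith
    refine (mul_le_mul_of_nonneg_left h1 (by positivity)).trans (le_of_eq ?_)
    field_simp
  -- the gain from moving in the direction `v`
  have hgain : σ * (δ / 2) ≤ ∑ i, κ i * a i ^ α * (z i ^ (-α) * (z i - ν i / μ i)) := by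
    have h1 : δ ≤ ∑ i, κ i * a i ^ α * (ν i / μ i) ^ (-α) * v i := by
      have h2 := liftObjective_tangent_le hp hL.1.1 ha
      have h3 : ∑ i, κ i * a i ^ α * (ν i / μ i) ^ (-α) * v i
          = -∑ i, liftGradient α κ ν μ a i * (m i - a i) := by
        rw [← Finset.sum_neg_distrib]
        refine Finset.sum_congr rfl fun i _ => ?_
        rw [← mul_liftGradient hp ha]
        have := (hp.mu i).ne'
        simp only [v]
        field_simp
        ring
      linarith
    have h4 : ∑ i, κ i * a i ^ α * (ν i / μ i) ^ (-α) * v i - ∑ i, κ i * (θ * V)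
        ≤ ∑ i, κ i * a i ^ α * z i ^ (-α) * v i := by
      rw [← Finset.sum_sub_distrib]
      refine Finset.sum_le_sum fun i _ => ?_
      have h5 : a i ^ α * (((ν i / μ i) ^ (-α) - z i ^ (-α)) * v i) ≤ 1 * (θ * V) := by
        refine mul_le_mul_of_nonneg (Real.rpow_le_one (ha i) (ha1 i) hα.le) ?_
          (Real.rpow_nonneg (ha i) _) (by positivity)
        refine (le_abs_self _).trans ?_
        rw [abs_mul, abs_sub_comm]
        exact mul_le_mul (hzθ i) (hv i) (abs_nonneg _) hθ.le
      have h6 := mul_le_mul_of_nonneg_left h5 (hp.kappa i).le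
      linarith
    have h7 : ∑ i, κ i * (θ * V) ≤ δ / 2 := by
      rw [← Finset.sum_mul]
      refine (mul_le_mul_of_nonneg_right hk (by positivity)).trans (le_of_eq ?_)
      simp only [θ]
      field_simp
    have h8 : ∑ i, κ i * a i ^ α * (z i ^ (-α) * (z i - ν i / μ i))
        = σ * ∑ i, κ i * a i ^ α * z i ^ (-α) * v i := by
      rw [Finset.mul_sum]
      exact Finset.sum_congr rfl fun i _ => by rw [hzρ]; ring
    rw [h8]
    exact mul_le_mul_of_nonneg_left (by linarith) hσ.le
  linarith

end Drift

/-! ### Approximate fluid paths -/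

section NearFluid

variable {I J : Type*} [Fintype I] [Fintype J] [DecidableEq J]

/-- A path `n` on `[0, τ]` with values in the unit cube which, over time intervals of length at
most one, solves the fluid model equations `n_i' = ν_i - μ_i x_i` with an error of at most `ε`,
where `x` is a fair allocation in the current state. -/
structure IsNearFluid (net : Network I J) (α : ℝ) (κ ν μ : I → ℝ) (τ ε : ℝ)
    (n x : ℝ → I → ℝ) : Prop where
  nonneg : ∀ t, 0 ≤ t → t ≤ τ → ∀ i, 0 ≤ n t i
  le_one : ∀ t, 0 ≤ t → t ≤ τ → ∀ i, n t i ≤ 1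
  fair : ∀ t, 0 ≤ t → t ≤ τ → IsFairRate net α κ (fun i => ν i / μ i) (n t) (x t)
  integrable : ∀ i s t, 0 ≤ s → s ≤ t → t ≤ τ → IntervalIntegrable (fun u => x u i) volume s t
  dynamics : ∀ s t, 0 ≤ s → s ≤ t → t ≤ τ → t - s ≤ 1 → ∀ i,
    |n t i - n s i - ∫ u in s..t, (ν i - μ i * x u i)| ≤ ε

variable {net : Network I J} {α : ℝ} {κ ν μ : I → ℝ} {τ ε : ℝ} {n x : ℝ → I → ℝ}

namespace IsNearFluid

theorem intervalIntegrable_rate (h : IsNearFluid net α κ ν μ τ ε n x) (i : I) {s t : ℝ}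
    (hs : 0 ≤ s) (hst : s ≤ t) (ht : t ≤ τ) :
    IntervalIntegrable (fun u => ν i - μ i * x u i) volume s t :=
  intervalIntegrable_const.sub ((h.integrable i s t hs hst ht).const_mul _)

theorem abs_sub_le (h : IsNearFluid net α κ ν μ τ ε n x) (hp : PosParams α κ ν μ) {L M : ℝ}
    (hM : ∀ x : I → ℝ, (∀ i, 0 ≤ x i) → (∀ j, ∑ i, net.A j i * x i ≤ net.capacity j) →
      ∀ i, x i ≤ M) (hL : ∀ i, ν i + μ i * M ≤ L) {s t : ℝ} (hs : 0 ≤ s) (hst : s ≤ t)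
    (ht : t ≤ τ) (hts : t - s ≤ 1) (i : I) : |n t i - n s i| ≤ L * (t - s) + ε := by
  have h1 := h.dynamics s t hs hst ht hts i
  have h2 : ‖∫ u in s..t, (ν i - μ i * x u i)‖ ≤ L * |t - s| := by
    refine intervalIntegral.norm_integral_le_of_norm_le_const fun u hu => ?_
    rw [Set.uIoc_of_le hst] at hu
    have hf := h.fair u (hs.trans hu.1.le) (hu.2.trans ht)
    have h3 := mul_le_mul_of_nonneg_left (hM _ hf.nonneg hf.capacity_le i) (hp.mu i).le
    have h4 := mul_nonneg (hp.mu i).le (hf.nonneg i)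
    have h5 := hL i
    have h6 := hp.nu i
    rw [Real.norm_eq_abs, abs_le]
    constructor <;> linarith
  rw [Real.norm_eq_abs, abs_of_nonneg (sub_nonneg.2 hst)] at h2
  rw [abs_le] at h1 h2 ⊢
  constructor <;> linarith [h1.1, h1.2, h2.1, h2.2]

/-- The workload of a fluid path is nondecreasing, because in critical load the capacities
equal the rate at which work arrives. -/
theorem workload_sub_le (h : IsNearFluid net α κ ν μ τ ε n x) (hp : PosParams α κ ν μ)
    (hcrit : ∀ j, ∑ i, net.A j i * (ν i / μ i) = net.capacity j) {s t : ℝ} (hs : 0 ≤ s)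
    (hst : s ≤ t) (ht : t ≤ τ) (hts : t - s ≤ 1) (j : J) :
    workload net μ (n s) j - (∑ i, (μ i)⁻¹) * ε ≤ workload net μ (n t) j := by
  have h1 : 0 ≤ ∑ i, net.A j i / μ i * ∫ u in s..t, (ν i - μ i * x u i) := by
    simp_rw [← intervalIntegral.integral_const_mul]
    rw [← intervalIntegral.integral_finsetSum fun i _ =>
      (h.intervalIntegrable_rate i hs hst ht).const_mul _]
    refine intervalIntegral.integral_nonneg hst fun u hu => ?_
    have hf := (h.fair u (hs.trans hu.1) (hu.2.trans ht)).capacity_le j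
    rw [← hcrit j, ← sub_nonneg, ← Finset.sum_sub_distrib] at hf
    refine hf.trans (le_of_eq (Finset.sum_congr rfl fun i _ => ?_))
    have := (hp.mu i).ne'
    field_simp
  have h2 : ∑ i, net.A j i / μ i * (∫ u in s..t, (ν i - μ i * x u i))
      - ∑ i, (μ i)⁻¹ * ε ≤ ∑ i, net.A j i / μ i * (n t i - n s i) := by
    rw [← Finset.sum_sub_distrib]
    refine Finset.sum_le_sum fun i _ => ?_
    have h3 := (abs_le.1 (h.dynamics s t hs hst ht hts i)).1
    have hε : 0 ≤ ε := (abs_nonneg _).trans (h.dynamics s t hs hst ht hts i)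
    have hA : net.A j i / μ i ≤ (μ i)⁻¹ := by
      rw [← one_div]
      exact div_le_div_of_nonneg_right (net.A_le_one j i) (hp.mu i).le
    have hA0 : 0 ≤ net.A j i / μ i := div_nonneg (net.A_nonneg j i) (hp.mu i).le
    nlinarith [mul_le_mul_of_nonneg_left h3 hA0, mul_le_mul_of_nonneg_right hA hε]
  have h4 : ∑ i, net.A j i / μ i * (n t i - n s i)
      = workload net μ (n t) j - workload net μ (n s) j := by
    rw [workload, workload, ← Finset.sum_sub_distrib]
    exact Finset.sum_congr rfl fun i _ => by ring
  rw [← Finset.sum_mul] at h2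
  linarith

/-- The change of the cost is the integral of the drift with frozen gradient, up to the modulus
of continuity `d` of the gradient and the error `ε` of the fluid path. -/
theorem liftObjective_sub_le (h : IsNearFluid net α κ ν μ τ ε n x) (hp : PosParams α κ ν μ)
    {s t G d e : ℝ} (hs : 0 ≤ s) (hst : s ≤ t) (ht : t ≤ τ) (hts : t - s ≤ 1)
    (hG : ∀ i, liftGradient α κ ν μ (n s) i ≤ G)
    (hd : ∀ i, |liftGradient α κ ν μ (n t) i - liftGradient α κ ν μ (n s) i| ≤ d)
    (he : ∀ i, |n t i - n s i| ≤ e) :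
    liftObjective α κ ν μ (n t) - liftObjective α κ ν μ (n s)
      ≤ (∫ u in s..t, ∑ i, liftGradient α κ ν μ (n s) i * (ν i - μ i * x u i))
        + Fintype.card I * (G * ε + d * e) := by
  have hns := h.nonneg s hs (hst.trans ht)
  have h1 := liftObjective_tangent_le hp hns (h.nonneg t (hs.trans hst) ht)
  rw [intervalIntegral.integral_finsetSum fun i _ =>
    (h.intervalIntegrable_rate i hs hst ht).const_mul _]
  simp_rw [intervalIntegral.integral_const_mul]
  have h2 : ∑ i, liftGradient α κ ν μ (n t) i * (n t i - n s i)
      ≤ ∑ i, (liftGradient α κ ν μ (n s) i * (∫ u in s..t, (ν i - μ i * x u i))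
        + (G * ε + d * e)) := by
    refine Finset.sum_le_sum fun i _ => ?_
    have h3 := h.dynamics s t hs hst ht hts i
    have h4 := mul_le_mul (hG i) h3 (abs_nonneg _)
      ((liftGradient_nonneg hp hns i).trans (hG i))
    have h5 := mul_le_mul_of_nonneg_left (le_abs_self
      (n t i - n s i - ∫ u in s..t, (ν i - μ i * x u i))) (liftGradient_nonneg hp hns i)
    have h6 := mul_le_mul (hd i) (he i) (abs_nonneg _) ((abs_nonneg _).trans (hd i))
    have h7 := le_abs_self ((liftGradient α κ ν μ (n t) i - liftGradient α κ ν μ (n s) i)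
      * (n t i - n s i))
    rw [abs_mul] at h7
    linarith
  rw [Finset.sum_add_distrib, Finset.sum_const, Finset.card_univ, nsmul_eq_mul] at h2
  have h8 : ∑ i, liftGradient α κ ν μ (n t) i * (n s i - n t i)
      = -∑ i, liftGradient α κ ν μ (n t) i * (n t i - n s i) := by
    rw [← Finset.sum_neg_distrib]
    exact Finset.sum_congr rfl fun i _ => by ring
  linarith

end IsNearFluid

theorem exists_liftGradient_modulus (hp : PosParams α κ ν μ) {d : ℝ} (hd : 0 < d) :
    ∃ η > 0, ∀ a b : I → ℝ, (∀ i, 0 ≤ a i) → (∀ i, a i ≤ 1) → (∀ i, 0 ≤ b i) → (∀ i, b i ≤ 1) →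
      (∀ i, |a i - b i| ≤ η) → ∀ i, |liftGradient α κ ν μ a i - liftGradient α κ ν μ b i| ≤ d := by
  have hc : Continuous (liftGradient α κ ν μ) := continuous_pi fun i => continuous_const.mul
    (((continuous_apply i).div_const _).rpow_const fun _ => Or.inr hp.alpha.le)
  obtain ⟨η, hη, h⟩ := Metric.uniformContinuousOn_iff.1
    ((isCompact_Icc (a := (0 : I → ℝ)) (b := fun _ => 1)).uniformContinuousOn_of_continuous
      hc.continuousOn) d hd
  refine ⟨η / 2, half_pos hη, fun a b ha ha1 hb hb1 hab i => ?_⟩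
  have h1 := h a ⟨ha, ha1⟩ b ⟨hb, hb1⟩ ((dist_pi_lt_iff hη).2 fun i => by
    rw [Real.dist_eq]
    linarith [hab i])
  have h2 := (dist_pi_lt_iff hd).1 h1 i
  rw [Real.dist_eq] at h2
  exact h2.le

/-- One time step of length `h`: the Lyapunov function grows by at most `δ` during the step, and
does not grow over the whole step if it is at least `δ` at the beginning. -/
theorem exists_step (hp : PosParams α κ ν μ) (hrow : ∀ j, ∃ i, j ∈ net.route i)
    (hcrit : ∀ j, ∑ i, net.A j i * (ν i / μ i) = net.capacity j) {δ : ℝ} (hδ : 0 < δ) :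
    ∃ h > 0, ∃ ε > 0, ∀ (τ : ℝ) (n x : ℝ → I → ℝ), IsNearFluid net α κ ν μ τ ε n x →
      (∀ s t, 0 ≤ s → s ≤ t → t ≤ τ → t - s ≤ h →
        costGap net α κ ν μ (n t) ≤ costGap net α κ ν μ (n s) + δ) ∧
      (∀ s, 0 ≤ s → s + h ≤ τ → δ ≤ costGap net α κ ν μ (n s) →
        costGap net α κ ν μ (n (s + h)) ≤ costGap net α κ ν μ (n s)) := by
  obtain ⟨c, hc, η, hη, hdrift⟩ := exists_drift_le hp hrow hcrit hδ
  obtain ⟨M, hM0, hM⟩ := exists_allocation_bound net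
  obtain ⟨L, hL0, hL⟩ := exists_pos_forall_ge fun i => ν i + μ i * M
  obtain ⟨G, hG0, hG⟩ := exists_liftGradient_bound (I := I) hp 1
  obtain ⟨C₁, hC₁, h₁⟩ := exists_liftObjective_lift_le (net := net) hp hrow
    (liftObjective α κ ν μ fun _ => 1)
  obtain ⟨C₂, hC₂, h₂⟩ := exists_liftObjective_lipschitz hp (1 : ℝ) (I := I)
  obtain ⟨B, hB0, hB⟩ := exists_pos_forall_ge fun _ : Unit => ∑ i, (μ i)⁻¹
  replace hB := hB ()
  obtain ⟨k, hk0, hk⟩ := exists_pos_forall_ge fun _ : Unit => (Fintype.card I : ℝ)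
  replace hk := hk ()
  -- the modulus `d` of the gradient has to beat the drift `c`
  let d : ℝ := c / (4 * k * L)
  have hd0 : 0 < d := by positivity
  obtain ⟨η', hη', hgrad⟩ := exists_liftGradient_modulus (I := I) hp hd0
  obtain ⟨h, hh0, hh1, hhη, hhη', hhδ⟩ : ∃ h > 0, h ≤ 1 ∧ L * h ≤ η / 2 ∧ L * h ≤ η' / 2 ∧
      C₂ * (L * h) ≤ δ / 4 := by
    refine ⟨min 1 (min (η / 2 / L) (min (η' / 2 / L) (δ / 4 / (C₂ * L)))), by positivity,
      min_le_left _ _, ?_, ?_, ?_⟩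
    · rw [mul_comm, ← le_div_iff₀ hL0]
      exact (min_le_right _ _).trans (min_le_left _ _)
    · rw [mul_comm, ← le_div_iff₀ hL0]
      exact (min_le_right _ _).trans ((min_le_right _ _).trans (min_le_left _ _))
    · rw [← mul_assoc, mul_comm, ← le_div_iff₀ (by positivity)]
      exact (min_le_right _ _).trans ((min_le_right _ _).trans (min_le_right _ _))
  -- the error of the path is chosen after the length of the step
  let E : ℝ := k * (G + d) + C₁ * B + C₂
  have hE : 0 < E := by positivity
  obtain ⟨ε, hε0, hεη, hεη', hεB, hεδ, hεc⟩ : ∃ ε > 0, ε ≤ η / 2 ∧ ε ≤ η' / 2 ∧ B * ε ≤ 1 ∧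
      E * ε ≤ δ / 4 ∧ E * ε ≤ c * h / 4 := by
    refine ⟨min (η / 2) (min (η' / 2) (min (1 / B) (min (δ / 4 / E) (c * h / 4 / E)))),
      by positivity, min_le_left _ _, (min_le_right _ _).trans (min_le_left _ _), ?_, ?_, ?_⟩
    · rw [mul_comm, ← le_div_iff₀ hB0]
      exact (min_le_right _ _).trans ((min_le_right _ _).trans (min_le_left _ _))
    · rw [mul_comm, ← le_div_iff₀ hE]
      exact (min_le_right _ _).trans ((min_le_right _ _).trans ((min_le_right _ _).trans
        (min_le_left _ _)))
    · rw [mul_comm, ← le_div_iff₀ hE]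
      exact (min_le_right _ _).trans ((min_le_right _ _).trans ((min_le_right _ _).trans
        (min_le_right _ _)))
  refine ⟨h, hh0, ε, hε0, fun τ n x hn => ?_⟩
  have hlift : ∀ s t, 0 ≤ s → s ≤ t → t ≤ τ → t - s ≤ h →
      costGap net α κ ν μ (n t) - costGap net α κ ν μ (n s)
        ≤ liftObjective α κ ν μ (n t) - liftObjective α κ ν μ (n s) + C₁ * B * ε := by
    intro s t hs hst ht hts
    have hnt := hn.nonneg t (hs.trans hst) ht
    have h3 := h₁ (workload net μ (n s)) (workload net μ (n t)) (B * ε) (by positivity) hεB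
      (fun j => by
        have := hn.workload_sub_le hp hcrit hs hst ht (hts.trans hh1) j
        have := mul_le_mul_of_nonneg_right hB hε0.le
        linarith)
      ((liftObjective_lift_workload_le hp hrow hnt).trans
        (liftObjective_mono hp hnt (hn.le_one t (hs.trans hst) ht)))
    unfold costGap
    linarith
  have hmove : ∀ s t, 0 ≤ s → s ≤ t → t ≤ τ → t - s ≤ h → ∀ i,
      |n t i - n s i| ≤ L * h + ε := fun s t hs hst ht hts i =>
    (hn.abs_sub_le hp hM hL hs hst ht (hts.trans hh1) i).trans
      (add_le_add (mul_le_mul_of_nonneg_left hts hL0.le) le_rfl)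
  refine ⟨fun s t hs hst ht hts => ?_, fun s hs hsτ hgap => ?_⟩
  · have h3 := hlift s t hs hst ht hts
    have h4 := h₂ (n s) (n t) (hn.nonneg s hs (hst.trans ht)) (hn.nonneg t (hs.trans hst) ht)
      (hn.le_one t (hs.trans hst) ht) (L * h + ε) (by positivity) (hmove s t hs hst ht hts)
    have h5 : 0 ≤ k * (G + d) * ε := by positivity
    simp only [E] at hεδ
    linarith
  · have hst : s ≤ s + h := by linarith
    have hns := hn.nonneg s hs (hst.trans hsτ)
    have hns1 := hn.le_one s hs (hst.trans hsτ)
    have h3 := hlift s (s + h) hs hst hsτ (by linarith)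
    have hstep : ∀ i, |n (s + h) i - n s i| ≤ L * h + ε := hmove s (s + h) hs hst hsτ (by linarith)
    have h4 := hn.liftObjective_sub_le hp hs hst hsτ (by linarith) (hG _ hns hns1)
      (hgrad _ _ (hn.nonneg _ (hs.trans hst) hsτ) (hn.le_one _ (hs.trans hst) hsτ) hns hns1
        fun i => (hstep i).trans (by linarith)) hstep
    have h5 : (∫ u in s..(s + h), ∑ i, liftGradient α κ ν μ (n s) i * (ν i - μ i * x u i))
        ≤ ∫ _u in s..(s + h), -c := by
      refine intervalIntegral.integral_mono_on hst ?_ intervalIntegrable_const fun u hu => ?_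
      · have hsum := IntervalIntegrable.sum Finset.univ fun i _ =>
          (hn.intervalIntegrable_rate i hs hst hsτ).const_mul (liftGradient α κ ν μ (n s) i)
        simpa only [Finset.sum_fn] using hsum
      · have huτ := hu.2.trans hsτ
        have hu0 := hs.trans hu.1
        refine hdrift (n s) (n u) (x u) hns hns1 (hn.nonneg u hu0 huτ) (hn.le_one u hu0 huτ)
          (fun i => ?_) hgap (hn.fair u hu0 huτ)
        rw [abs_sub_comm]
        exact (hmove s u hs hu.1 huτ (by linarith [hu.2]) i).trans (by linarith)
    rw [intervalIntegral.integral_const, smul_eq_mul, add_sub_cancel_left] at h5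
    have h6 : (Fintype.card I : ℝ) * (G * ε + d * (L * h + ε))
        ≤ k * (G * ε + d * (L * h + ε)) := mul_le_mul_of_nonneg_right hk (by positivity)
    have h7 : k * (d * (L * h)) = c * h / 4 := by
      simp only [d]
      field_simp
    have h8 : 0 ≤ C₂ * ε := by positivity
    have h9 : 0 < c * h := by positivity
    simp only [E] at hεc
    linarith

/-- Along approximate fluid paths the Lyapunov function stays small, for arbitrarily long
times. -/
theorem exists_costGap_le_of_isNearFluid (hp : PosParams α κ ν μ)
    (hrow : ∀ j, ∃ i, j ∈ net.route i)
    (hcrit : ∀ j, ∑ i, net.A j i * (ν i / μ i) = net.capacity j) {δ : ℝ} (hδ : 0 < δ) :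
    ∃ ε > 0, ∀ (τ : ℝ) (n x : ℝ → I → ℝ), IsNearFluid net α κ ν μ τ ε n x →
      costGap net α κ ν μ (n 0) ≤ δ → ∀ t, 0 ≤ t → t ≤ τ → costGap net α κ ν μ (n t) ≤ 3 * δ := by
  obtain ⟨h, hh, ε, hε, hstep⟩ := exists_step (net := net) hp hrow hcrit hδ
  refine ⟨ε, hε, fun τ n x hn h0 t ht htτ => ?_⟩
  obtain ⟨hgrow, hdesc⟩ := hstep τ n x hn
  have hgrid : ∀ k : ℕ, k * h ≤ τ → costGap net α κ ν μ (n (k * h)) ≤ 2 * δ := by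
    intro k
    induction k with
    | zero =>
      intro _
      simp only [Nat.cast_zero, zero_mul]
      linarith
    | succ k ih =>
      intro hk
      push_cast at hk ⊢
      have hk0 : 0 ≤ (k : ℝ) * h := by positivity
      have ih := ih (by linarith)
      have hkk : ((k : ℝ) + 1) * h = k * h + h := by ring
      rw [hkk] at hk ⊢
      rcases le_total (costGap net α κ ν μ (n (k * h))) δ with h1 | h1
      · have := hgrow (k * h) (k * h + h) hk0 (by linarith) hk (by linarith)
        linarith
      · exact (hdesc _ hk0 hk h1).trans ih
  have h1 := Nat.floor_le (div_nonneg ht hh.le)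
  have h2 := Nat.lt_floor_add_one (t / h)
  rw [le_div_iff₀ hh] at h1
  rw [div_lt_iff₀ hh] at h2
  have h3 := hgrow (⌊t / h⌋₊ * h) t (by positivity) h1 htτ (by linarith)
  have h4 := hgrid ⌊t / h⌋₊ (h1.trans htτ)
  linarith

end NearFluid

/-! ### Large deviations of sums of exponential variables -/

section Exponential

/-- Tilting: `exp (t * x)` times the exponential density of rate `a` is, up to a constant, the
exponential density of rate `a - t`. -/
theorem lintegral_exp_mul_expMeasure {a t : ℝ} (ha : 0 < a) (ht : t < a) :
    ∫⁻ x, ENNReal.ofReal (Real.exp (t * x)) ∂expMeasure a = ENNReal.ofReal (a / (a - t)) := by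
  have hpdf : ∀ x, exponentialPDF a x * ENNReal.ofReal (Real.exp (t * x))
      = ENNReal.ofReal (a / (a - t)) * exponentialPDF (a - t) x := fun x => by
    have hat : a - t ≠ 0 := by linarith
    rcases lt_or_ge x 0 with hx | hx
    · rw [exponentialPDF_of_neg hx, exponentialPDF_of_neg hx, zero_mul, mul_zero]
    · rw [exponentialPDF_of_nonneg hx, exponentialPDF_of_nonneg hx,
        ← ENNReal.ofReal_mul (by positivity),
        ← ENNReal.ofReal_mul (div_nonneg ha.le (by linarith)), mul_assoc, ← Real.exp_add,
        ← mul_assoc, div_mul_cancel₀ _ hat]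
      congr 3
      ring
  have hm : Measurable (exponentialPDF a) := (measurable_exponentialPDFReal a).ennreal_ofReal
  have h1 : expMeasure a = volume.withDensity (exponentialPDF a) := rfl
  rw [h1, lintegral_withDensity_eq_lintegral_mul _ hm (by fun_prop)]
  simp only [Pi.mul_apply, hpdf]
  have hm' : Measurable (exponentialPDF (a - t)) :=
    (measurable_exponentialPDFReal _).ennreal_ofReal
  rw [lintegral_const_mul _ hm', lintegral_exponentialPDF_eq_one (by linarith), mul_one]

theorem expMeasure_Iio_zero (a : ℝ) : expMeasure a (Set.Iio 0) = 0 := by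
  have h1 : expMeasure a = volume.withDensity (exponentialPDF a) := rfl
  rw [h1, withDensity_apply _ measurableSet_Iio]
  exact lintegral_exponentialPDF_of_nonpos le_rfl

theorem one_div_one_sub_le_exp {u : ℝ} (hu : |u| ≤ 1 / 2) :
    1 / (1 - u) ≤ Real.exp (u + u ^ 2) := by
  have hu' := abs_le.1 hu
  rcases le_total 0 u with h | h
  · refine le_trans ?_ (Real.quadratic_le_exp_of_nonneg (by positivity))
    rw [div_le_iff₀ (by linarith)]
    have : 0 ≤ u ^ 2 * (1 - 2 * u) * (1 + u) := by
      have : 0 ≤ 1 - 2 * u := by linarith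
      positivity
    nlinarith [pow_nonneg h 3, pow_nonneg h 4]
  · have h1 := Real.add_one_le_exp (u + u ^ 2)
    rw [div_le_iff₀ (by linarith)]
    have h2 : 0 ≤ (-u) ^ 3 := pow_nonneg (by linarith) 3
    have h3 := mul_le_mul_of_nonneg_right h1 (by linarith : (0 : ℝ) ≤ 1 - u)
    linarith

variable {Ω : Type*} [MeasurableSpace Ω] {P : Measure Ω}

theorem integrable_exp_mul_of_map_eq_expMeasure {X : Ω → ℝ} {a t : ℝ} (hX : Measurable X)
    (ha : 0 < a) (ht : t < a) (hlaw : P.map X = expMeasure a) :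
    Integrable (fun ω => Real.exp (t * X ω)) P := by
  refine ⟨by fun_prop, ?_⟩
  rw [hasFiniteIntegral_iff_ofReal (ae_of_all _ fun _ => (Real.exp_pos _).le),
    ← lintegral_map (f := fun x => ENNReal.ofReal (Real.exp (t * x))) (by fun_prop) hX, hlaw,
    lintegral_exp_mul_expMeasure ha ht]
  exact ENNReal.ofReal_lt_top

theorem mgf_of_map_eq_expMeasure {X : Ω → ℝ} {a t : ℝ} (hX : Measurable X)
    (ha : 0 < a) (ht : t < a) (hlaw : P.map X = expMeasure a) : mgf X P t = a / (a - t) := by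
  rw [mgf, integral_eq_lintegral_of_nonneg_ae (ae_of_all _ fun _ => (Real.exp_pos _).le)
    (by fun_prop), ← lintegral_map (f := fun x => ENNReal.ofReal (Real.exp (t * x))) (by fun_prop)
    hX, hlaw, lintegral_exp_mul_expMeasure ha ht,
    ENNReal.toReal_ofReal (div_nonneg ha.le (by linarith))]

/-- Chernoff bound, for both tails: the deviations of a sum of independent exponential variables,
normalized to mean one, beyond `ε` times the number of terms plus `ε * r` are exponentially
unlikely in `r`, uniformly in the number of terms. -/
theorem measure_le_abs_sum_le [IsProbabilityMeasure P] {X : ℕ → Ω → ℝ} {a : ℝ} (ha : 0 < a)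
    (hX : ∀ k, Measurable (X k)) (hlaw : ∀ k, P.map (X k) = expMeasure a) (hind : iIndepFun X P) {ε r : ℝ} (hε : 0 < ε)
    (hε' : ε ≤ 1 / 2) (s : Finset ℕ) :
    P {ω | ε * (r + s.card) ≤ |∑ k ∈ s, (a * X k ω - 1)|}
      ≤ ENNReal.ofReal (2 * Real.exp (-(ε ^ 2 * r))) := by
  let Z : ℕ → Ω → ℝ := fun k ω => a * X k ω - 1
  have hZm : ∀ k, Measurable (Z k) := fun k => ((hX k).const_mul a).sub_const 1
  have hZind : iIndepFun Z P := hind.comp (fun _ x => a * x - 1) fun _ => by fun_prop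
  have hmgf : ∀ u : ℝ, |u| ≤ 1 / 2 → ∀ k, Integrable (fun ω => Real.exp (u * Z k ω)) P ∧
      mgf (Z k) P u ≤ Real.exp (u ^ 2) := fun u hu k => by
    have hua : u * a < a := by
      have := (abs_le.1 hu).2
      nlinarith
    have h1 : ∀ ω, Real.exp (u * Z k ω) = Real.exp (-u) * Real.exp (u * a * X k ω) := fun ω => by
      rw [← Real.exp_add]
      simp only [Z]
      congr 1
      ring
    constructor
    · simp only [h1]
      exact (integrable_exp_mul_of_map_eq_expMeasure (hX k) ha hua (hlaw k)).const_mul _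
    · have h2 : mgf (Z k) P u = Real.exp (-u) * mgf (X k) P (u * a) := by
        simp only [mgf, h1, integral_const_mul]
      have hu1 : 1 - u ≠ 0 := by
        have := (abs_le.1 hu).2
        linarith
      have h3 : a / (a - u * a) = 1 / (1 - u) := by
        have : a - u * a ≠ 0 := by linarith
        field_simp
      rw [h2, mgf_of_map_eq_expMeasure (hX k) ha hua (hlaw k), h3]
      refine (mul_le_mul_of_nonneg_left (one_div_one_sub_le_exp hu) (Real.exp_pos _).le).trans ?_
      rw [← Real.exp_add]
      exact Real.exp_le_exp.2 (by linarith)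
  have hsum : ∀ u : ℝ, |u| = ε → Integrable (fun ω => Real.exp (u * (∑ k ∈ s, Z k) ω)) P ∧
      Real.exp (-(ε * (ε * (r + s.card)))) * mgf (∑ k ∈ s, Z k) P u
        ≤ Real.exp (-(ε ^ 2 * r)) := fun u hu => by
    have hu2 : u ^ 2 = ε ^ 2 := by rw [← sq_abs, hu]
    refine ⟨hZind.integrable_exp_mul_sum hZm fun k _ => (hmgf u (hu.le.trans hε') k).1, ?_⟩
    rw [hZind.mgf_sum hZm]
    have h1 : ∏ k ∈ s, mgf (Z k) P u ≤ ∏ _k ∈ s, Real.exp (u ^ 2) :=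
      Finset.prod_le_prod (fun _ _ => mgf_nonneg) fun k _ => (hmgf u (hu.le.trans hε') k).2
    rw [Finset.prod_const, ← Real.exp_nat_mul, hu2] at h1
    refine (mul_le_mul_of_nonneg_left h1 (Real.exp_pos _).le).trans ?_
    rw [← Real.exp_add]
    exact Real.exp_le_exp.2 (by linarith)
  obtain ⟨hint1, hb1⟩ := hsum ε (abs_of_pos hε)
  obtain ⟨hint2, hb2⟩ := hsum (-ε) (by rw [abs_neg, abs_of_pos hε])
  have hup := measure_ge_le_exp_mul_mgf (ε * (r + s.card)) hε.le hint1
  have hlo := measure_le_le_exp_mul_mgf (-(ε * (r + s.card))) (by linarith) hint2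
  have hsub : {ω | ε * (r + s.card) ≤ |∑ k ∈ s, (a * X k ω - 1)|}
      ⊆ {ω | ε * (r + s.card) ≤ (∑ k ∈ s, Z k) ω}
        ∪ {ω | (∑ k ∈ s, Z k) ω ≤ -(ε * (r + s.card))} := fun ω hω => by
    simp only [Set.mem_union, Set.mem_ofPred_eq, Finset.sum_apply, Z] at hω ⊢
    rcases le_abs.1 hω with h | h
    · exact Or.inl h
    · exact Or.inr (by linarith)
  have h1 := (measureReal_mono (μ := P) hsub).trans (measureReal_union_le _ _)
  rw [← ofReal_measureReal]
  refine ENNReal.ofReal_le_ofReal ?_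
  rw [show -ε * (ε * (r + (s.card : ℝ))) = -(ε * (ε * (r + s.card))) by ring] at hup
  rw [show - -ε * -(ε * (r + (s.card : ℝ))) = -(ε * (ε * (r + s.card))) by ring] at hlo
  linarith

end Exponential

/-! ### Renewal counting processes -/

section Renewal

theorem renewalCount_mul {X : ℕ → ℝ} {a : ℝ} (ha : 0 < a) (t : ℝ) :
    renewalCount (fun k => a * X k) (a * t) = renewalCount X t := by
  unfold renewalCount
  congr 1
  ext n
  simp only [Set.mem_ofPred_eq, ← Finset.mul_sum]
  exact mul_le_mul_iff_right₀ ha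

/-- Inversion: if the partial sums of `X` have unit rate up to small errors, so does the counting
process of `X`. -/
theorem abs_renewalCount_sub_le {X : ℕ → ℝ} (hX : ∀ k, 0 ≤ X k) {ε r T : ℝ} {N : ℕ} (hε : 0 < ε)
    (hε' : ε ≤ 1 / 4) (hεr : 1 ≤ ε * r) (hN : 2 * T + r + 1 ≤ N)
    (hdev : ∀ m n, m ≤ n → n ≤ N →
      |∑ k ∈ Finset.Ico m n, (X k - 1)| ≤ ε * (r + (Finset.Ico m n).card))
    {s t : ℝ} (hs : 0 ≤ s) (hst : s ≤ t) (ht : t ≤ T) :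
    |(renewalCount X t : ℝ) - renewalCount X s - (t - s)| ≤ 3 * ε * (r + (t - s)) := by
  let V : ℕ → ℝ := fun n => ∑ k ∈ Finset.range n, X k
  have hVmono : Monotone V := fun m n hmn =>
    Finset.sum_le_sum_of_subset_of_nonneg (Finset.range_mono hmn) fun k _ _ => hX k
  have hV : ∀ m n, m ≤ n → n ≤ N → |V n - V m - (n - m)| ≤ ε * (r + (n - m)) := by
    intro m n hmn hnN
    have h := hdev m n hmn hnN
    rwa [Finset.sum_sub_distrib, Finset.sum_Ico_eq_sub _ hmn, Finset.sum_const, Nat.card_Ico,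
      nsmul_eq_mul, mul_one, Nat.cast_sub hmn] at h
  have hVN : T < V N := by
    have h := (abs_le.1 (hV 0 N (Nat.zero_le _) le_rfl)).1
    have h0 : V 0 = 0 := by simp [V]
    rw [h0] at h
    push_cast at h
    have hr : 0 < r := pos_of_mul_pos_right (by linarith) hε.le
    have h1 := mul_le_mul_of_nonneg_right hε' (by positivity : 0 ≤ r + (N : ℝ))
    linarith
  have hset : ∀ u, 0 ≤ u → u ≤ T → V (renewalCount X u) ≤ u ∧ u < V (renewalCount X u + 1) ∧
      renewalCount X u < N := by
    intro u hu huT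
    have hlt : ∀ n, V n ≤ u → n < N := fun n hn => by
      by_contra! h
      have := hVmono h
      linarith
    have hbdd : BddAbove {n : ℕ | V n ≤ u} := ⟨N, fun n hn => (hlt n hn).le⟩
    have hmem : V (renewalCount X u) ≤ u := Nat.sSup_mem (s := {n : ℕ | V n ≤ u})
      ⟨0, by simpa [V] using hu⟩ hbdd
    refine ⟨hmem, ?_, hlt _ hmem⟩
    by_contra! h
    have : renewalCount X u + 1 ≤ renewalCount X u := le_csSup hbdd h
    omega
  obtain ⟨hs1, hs2, hsN⟩ := hset s hs (hst.trans ht)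
  obtain ⟨ht1, ht2, htN⟩ := hset t (hs.trans hst) ht
  set m := renewalCount X s
  set n := renewalCount X t
  have hmn : m ≤ n := by
    by_contra! h
    have := hVmono (Nat.succ_le_of_lt h)
    simp only [Nat.succ_eq_add_one] at this
    linarith
  have hlow := (abs_le.1 (hV m (n + 1) (by omega) htN)).2
  have hmn' : (m : ℝ) ≤ n := by exact_mod_cast hmn
  have hts : 0 ≤ t - s := sub_nonneg.2 hst
  push_cast at hlow
  rw [abs_le]
  constructor
  · by_contra! h
    have h1 := mul_lt_mul_of_pos_right (add_lt_add_left h 1) (by linarith : 0 < 1 + ε)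
    have h2 := mul_le_mul_of_nonneg_left hεr hε.le
    have h3 := mul_nonneg hts hε.le
    have h4 := mul_nonneg h3 hε.le
    linarith
  · rcases hmn.eq_or_lt with h | h
    · rw [h]
      nlinarith
    · have hup := (abs_le.1 (hV (m + 1) n h htN.le)).1
      have hmn1 : (m : ℝ) + 1 ≤ n := by exact_mod_cast h
      push_cast at hup
      -- `k - 1 - ε (r + k - 1) ≤ t - s` for the increment `k` of the count
      have h1 : ((n : ℝ) - (m + 1)) * (1 - ε) ≤ (t - s) + ε * r := by linarith
      have h2 : (n : ℝ) - (m + 1) ≤ ((t - s) + ε * r) * (1 + 2 * ε) := by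
        have h3 : 1 ≤ (1 - ε) * (1 + 2 * ε) := by nlinarith
        have h4 := mul_le_mul_of_nonneg_right h1 (by linarith : (0 : ℝ) ≤ 1 + 2 * ε)
        nlinarith
      nlinarith

end Renewal

section RenewalRate

/-- The increments of the counting function `c` over subintervals of `[0, T]` are those of a flow
of rate `a`, up to a relative error `e` and an absolute error `e * r`. -/
def HasRate (c : ℝ → ℕ) (a r T e : ℝ) : Prop :=
  ∀ s t, 0 ≤ s → s ≤ t → t ≤ T → |(c t : ℝ) - c s - a * (t - s)| ≤ e * (r + a * (t - s))

theorem tendsto_pow_four_mul_exp_neg {r : ℕ → ℝ} (hr : Tendsto r atTop atTop) {q : ℝ} (hq : 0 < q)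
    (D : ℝ) : Tendsto (fun l => D * (r l ^ 4 * Real.exp (-(q * r l)))) atTop (𝓝 0) := by
  have h1 := (Real.tendsto_pow_mul_exp_neg_atTop_nhds_zero 4).comp (hr.const_mul_atTop hq)
  have h2 := h1.const_mul (D / q ^ 4)
  rw [mul_zero] at h2
  refine h2.congr fun l => ?_
  simp only [Function.comp]
  field_simp

/-- Poisson processes keep to their rates over a time horizon of order `r ^ 2`, with an error of
order `e * r`, with probability tending to one. The Chernoff bound is exponentially small in `r`,
which beats the number `O(r ^ 4)` of pairs of indices. -/
theorem tendsto_measure_not_hasRate {Ω : ℕ → Type*} [∀ l, MeasurableSpace (Ω l)]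
    (P : ∀ l, Measure (Ω l)) [∀ l, IsProbabilityMeasure (P l)] (X : ∀ l, ℕ → Ω l → ℝ)
    {a r : ℕ → ℝ} {b K e : ℝ} (ha : ∀ l, 0 < a l) (hab : ∀ᶠ l in atTop, a l ≤ b)
    (hr : Tendsto r atTop atTop) (hK : 0 ≤ K) (he : 0 < e) (he' : e ≤ 1 / 4)
    (hX : ∀ l k, Measurable (X l k)) (hlaw : ∀ l k, (P l).map (X l k) = expMeasure (a l))
    (hind : ∀ l, iIndepFun (X l) (P l)) :
    Tendsto (fun l => P l {ω | ¬ HasRate (renewalCount fun k => X l k ω) (a l) (r l)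
      (K * r l ^ 2) (3 * e)}) atTop (𝓝 0) := by
  have hb : 0 < b := by
    obtain ⟨l, hl⟩ := hab.exists
    exact (ha l).trans_le hl
  let D : ℝ := 2 * (b * K) + 4
  have hlim := ENNReal.tendsto_ofReal
    (tendsto_pow_four_mul_exp_neg hr (by positivity : 0 < e ^ 2) (D ^ 2 * 2))
  rw [ENNReal.ofReal_zero] at hlim
  refine tendsto_of_tendsto_of_tendsto_of_le_of_le' tendsto_const_nhds hlim
    (Eventually.of_forall fun _ => zero_le) ?_
  filter_upwards [hab, hr.eventually_ge_atTop 1, hr.eventually_ge_atTop (1 / e)] with l hal hr1 hre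
  rw [div_le_iff₀' he] at hre
  let N : ℕ := ⌈2 * (b * (K * r l ^ 2)) + r l + 1⌉₊
  have hN := Nat.le_ceil (2 * (b * (K * r l ^ 2)) + r l + 1)
  have hN' : (N : ℝ) + 1 ≤ D * r l ^ 2 := by
    have h1 := (Nat.ceil_lt_add_one (by positivity : 0 ≤ 2 * (b * (K * r l ^ 2)) + r l + 1)).le
    have h2 : r l ≤ r l ^ 2 := by nlinarith
    have h3 : D * r l ^ 2 = 2 * (b * (K * r l ^ 2)) + 4 * r l ^ 2 := by simp only [D]; ring
    change ((⌈2 * (b * (K * r l ^ 2)) + r l + 1⌉₊ : ℕ) : ℝ) + 1 ≤ D * r l ^ 2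
    linarith
  let dev : ℕ → ℕ → Set (Ω l) := fun m n => {ω | e * (r l + (Finset.Ico m n).card)
    ≤ |∑ k ∈ Finset.Ico m n, (a l * X l k ω - 1)|}
  have hsub : {ω | ¬ HasRate (renewalCount fun k => X l k ω) (a l) (r l) (K * r l ^ 2) (3 * e)}
      ⊆ (⋃ k, X l k ⁻¹' Set.Iio 0)
        ∪ ⋃ m ∈ Finset.range (N + 1), ⋃ n ∈ Finset.range (N + 1), dev m n := by
    intro ω hω
    by_contra hcon
    simp only [Set.mem_union, Set.mem_iUnion, Finset.mem_range, Set.mem_preimage, Set.mem_Iio,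
      not_or, not_exists, not_lt] at hcon
    refine hω fun s t hs hst ht => ?_
    have h := abs_renewalCount_sub_le (X := fun k => a l * X l k ω) (ε := e) (r := r l)
      (T := a l * (K * r l ^ 2)) (N := N) (s := a l * s) (t := a l * t)
      (fun k => mul_nonneg (ha l).le (hcon.1 k)) he he' hre ?_ ?_
      (mul_nonneg (ha l).le hs) (mul_le_mul_of_nonneg_left hst (ha l).le)
      (mul_le_mul_of_nonneg_left ht (ha l).le)
    · rwa [renewalCount_mul (ha l), renewalCount_mul (ha l), ← mul_sub] at h
    · have := mul_le_mul_of_nonneg_right hal (by positivity : 0 ≤ K * r l ^ 2)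
      linarith
    · intro m n hmn hnN
      have := hcon.2 m (by omega) n (by omega)
      simp only [dev, Set.mem_ofPred_eq, not_le] at this
      exact this.le
  have hneg : P l (⋃ k, X l k ⁻¹' Set.Iio 0) = 0 := by
    refine measure_iUnion_null fun k => ?_
    rw [← Measure.map_apply (hX l k) measurableSet_Iio, hlaw, expMeasure_Iio_zero]
  calc P l _ ≤ _ := measure_mono hsub
    _ ≤ 0 + ∑ _m ∈ Finset.range (N + 1), ∑ _n ∈ Finset.range (N + 1),
          ENNReal.ofReal (2 * Real.exp (-(e ^ 2 * r l))) := by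
        refine (measure_union_le _ _).trans (add_le_add hneg.le ?_)
        refine (measure_biUnion_finset_le _ _).trans (Finset.sum_le_sum fun m _ => ?_)
        refine (measure_biUnion_finset_le _ _).trans (Finset.sum_le_sum fun n _ => ?_)
        exact measure_le_abs_sum_le (ha l) (hX l) (hlaw l) (hind l) he (by linarith) _
    _ = ENNReal.ofReal (((N : ℝ) + 1) ^ 2 * (2 * Real.exp (-(e ^ 2 * r l)))) := by
        simp only [Finset.sum_const, Finset.card_range, nsmul_eq_mul, zero_add]
        rw [ENNReal.ofReal_mul (p := ((N : ℝ) + 1) ^ 2) (by positivity),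
          ENNReal.ofReal_pow (by positivity),
          ← Nat.cast_succ, ENNReal.ofReal_natCast]
        ring
    _ ≤ ENNReal.ofReal (D ^ 2 * 2 * (r l ^ 4 * Real.exp (-(e ^ 2 * r l)))) := by
        refine ENNReal.ofReal_le_ofReal ?_
        have h1 := pow_le_pow_left₀ (by positivity) hN' 2
        refine (mul_le_mul_of_nonneg_right h1 (by positivity)).trans (le_of_eq (by ring))

end RenewalRate

/-! ### From the flow counts to approximate fluid paths -/

section Paths

theorem aemeasurable_of_rightContinuous {φ : ℝ → ℝ}
    (hφ : ∀ t, 0 ≤ t → ContinuousWithinAt φ (Set.Ici t) t) :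
    AEMeasurable φ (volume.restrict (Set.Ici 0)) := by
  -- approximate from the right along the grids of mesh `1 / (k + 1)`
  let g : ℕ → ℝ → ℝ := fun k u => ((⌊((k : ℝ) + 1) * u⌋ : ℝ) + 1) / ((k : ℝ) + 1)
  have hgu : ∀ k u, u ≤ g k u := fun k u => by
    rw [le_div_iff₀ (by positivity), mul_comm]
    exact (Int.lt_floor_add_one _).le
  have hgu' : ∀ k u, g k u ≤ u + 1 / ((k : ℝ) + 1) := fun k u => by
    have := Int.floor_le (((k : ℝ) + 1) * u)
    have h : (u + 1 / ((k : ℝ) + 1)) * ((k : ℝ) + 1) = ((k : ℝ) + 1) * u + 1 := by field_simp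
    rw [div_le_iff₀ (by positivity), h]
    linarith
  refine aemeasurable_of_tendsto_metrizable_ae atTop (f := fun k u => φ (g k u)) (fun k => ?_) ?_
  · have h1 : Measurable fun z : ℤ => φ (((z : ℝ) + 1) / ((k : ℝ) + 1)) := measurable_from_top
    exact (h1.comp (Int.measurable_floor.comp (measurable_const_mul _))).aemeasurable
  · filter_upwards [ae_restrict_mem measurableSet_Ici] with u hu
    refine (hφ u hu).tendsto.comp (tendsto_nhdsWithin_iff.2
      ⟨?_, Eventually.of_forall fun k => hgu k u⟩)
    refine tendsto_of_tendsto_of_tendsto_of_le_of_le tendsto_const_nhds ?_ (fun k => hgu k u)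
      fun k => hgu' k u
    simpa using (tendsto_one_div_add_atTop_nhds_zero_nat (𝕜 := ℝ)).const_add u

theorem intervalIntegrable_comp_of_rightContinuous {E : Type*} [TopologicalSpace E]
    [DiscreteTopology E] {f : ℝ → E} (hf : ∀ t, 0 ≤ t → ContinuousWithinAt f (Set.Ici t) t)
    (g : E → ℝ) {M : ℝ} (hg : ∀ x, |g x| ≤ M) {s t : ℝ} (hs : 0 ≤ s) (hst : s ≤ t) :
    IntervalIntegrable (fun u => g (f u)) volume s t := by
  rw [intervalIntegrable_iff_integrableOn_Ioc_of_le hst]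
  have h1 : AEMeasurable (fun u => g (f u)) (volume.restrict (Set.Ici 0)) :=
    aemeasurable_of_rightContinuous fun u hu =>
      (continuous_of_discreteTopology (f := g)).continuousAt.comp_continuousWithinAt (hf u hu)
  have h2 : AEStronglyMeasurable (fun u => g (f u)) (volume.restrict (Set.Ioc s t)) :=
    (h1.mono_set fun u hu => hs.trans hu.1.le).aestronglyMeasurable
  exact Integrable.of_bound h2 M (ae_of_all _ fun u => hg _)

variable {I J : Type*} [Fintype I] [Fintype J] [DecidableEq J]
variable {net : Network I J} {α : ℝ} {κ ν μ : I → ℝ}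

/-- If arrivals and services keep to their rates, the flow counts divided by an upper bound `Y` are
an approximate fluid path, time being accelerated by the same factor `Y`. -/
theorem isNearFluid_of_hasRate (hp : PosParams α κ ν μ) {N : ℝ → I → ℕ}
    (hN : ∀ t, 0 ≤ t → ContinuousWithinAt N (Set.Ici t) t) {A S : I → ℝ → ℕ}
    {ν' μ' : I → ℝ} {M r R Y e ε : ℝ} (hr : 0 < r) (hrY : r ≤ Y) (he : 0 ≤ e) (he1 : e ≤ 1)
    (hM : ∀ x : I → ℝ, (∀ i, 0 ≤ x i) → (∀ j, ∑ i, net.A j i * x i ≤ net.capacity j) →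
      ∀ i, x i ≤ M)
    (hM0 : 0 ≤ M) (hν' : ∀ i, |ν' i - ν i| ≤ e) (hμ' : ∀ i, |μ' i - μ i| ≤ e)
    (hε : ∀ i, (4 + ν i + (μ i + 2) * M) * e ≤ ε)
    (hA : ∀ i, HasRate (A i) (ν' i) r R e) (hS : ∀ i, HasRate (S i) (μ' i) r (M * R) e)
    (hdyn : ∀ i t, 0 ≤ t → (N t i : ℤ) = N 0 i + A i t
      - S i (∫ s in (0 : ℝ)..t, allocation net α κ (fun i' => (N s i' : ℝ)) i))
    (hY : ∀ t, 0 ≤ t → t ≤ R → ∀ i, (N t i : ℝ) ≤ Y) :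
    IsNearFluid net α κ ν μ (R / Y) ε (fun t i => (N (Y * t) i : ℝ) / Y)
      (fun t => allocation net α κ fun i => (N (Y * t) i : ℝ)) := by
  have hY0 : 0 < Y := hr.trans_le hrY
  have hfair : ∀ t, IsFairRate net α κ (fun i => ν i / μ i) (fun i => (N t i : ℝ))
      (allocation net α κ fun i => (N t i : ℝ)) := fun t =>
    isFairRate_allocation hp.alpha hp.kappa (fun i => Nat.cast_nonneg _)
      fun i => div_pos (hp.nu i) (hp.mu i)
  have hint : ∀ i s t, 0 ≤ s → s ≤ t → IntervalIntegrable
      (fun u => allocation net α κ (fun i' => (N u i' : ℝ)) i) volume s t := fun i s t hs hst => by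
    refine intervalIntegrable_comp_of_rightContinuous hN
      (fun m : I → ℕ => allocation net α κ (fun i' => (m i' : ℝ)) i) (M := M) (fun m => ?_) hs hst
    have h := isFairRate_allocation (net := net) (n := fun i' => (m i' : ℝ)) hp.alpha hp.kappa
      (fun i => Nat.cast_nonneg _) (fun i => div_pos (hp.nu i) (hp.mu i))
    rw [abs_of_nonneg (h.nonneg i)]
    exact hM _ h.nonneg h.capacity_le i
  have hYt : ∀ t, t ≤ R / Y → Y * t ≤ R := fun t ht => by
    rw [le_div_iff₀ hY0] at ht
    linarith
  refine ⟨fun t _ _ i => by positivity, fun t ht htR i => ?_, fun t _ _ => ?_,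
    fun i s t hs hst htR => ?_, fun s t hs hst htR hts i => ?_⟩
  · rw [div_le_one hY0]
    exact hY _ (by positivity) (hYt t htR) i
  · have h := (hfair (Y * t)).smul (fun i => Nat.cast_nonneg _) (inv_nonneg.2 hY0.le)
    have h2 : (Y⁻¹ • fun i => (N (Y * t) i : ℝ)) = fun i => (N (Y * t) i : ℝ) / Y := by
      funext i
      simp [inv_mul_eq_div]
    rwa [h2] at h
  · have h := (hint i (Y * s) (Y * t) (by positivity)
      (mul_le_mul_of_nonneg_left hst hY0.le)).comp_mul_left (c := Y)
    simpa [mul_div_cancel_left₀ _ hY0.ne'] using h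
  · have hYs0 : 0 ≤ Y * s := by positivity
    have hYst : Y * s ≤ Y * t := mul_le_mul_of_nonneg_left hst hY0.le
    set Λ : ℝ → ℝ := fun u => allocation net α κ (fun i' => (N u i' : ℝ)) i
    have hΛ0 : ∀ u, 0 ≤ Λ u := fun u => (hfair u).nonneg i
    have hΛM : ∀ u, Λ u ≤ M := fun u => hM _ (hfair u).nonneg (hfair u).capacity_le i
    have hbound : ∀ a b, 0 ≤ a → a ≤ b → 0 ≤ ∫ u in a..b, Λ u ∧ ∫ u in a..b, Λ u ≤ M * (b - a) := by
      intro a b ha hab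
      refine ⟨intervalIntegral.integral_nonneg hab fun u _ => hΛ0 u, ?_⟩
      have h := intervalIntegral.integral_mono_on hab (hint i a b ha hab)
        (intervalIntegrable_const (c := M)) fun u _ => hΛM u
      rwa [intervalIntegral.integral_const, smul_eq_mul, mul_comm] at h
    have hint' : ∫ u in s..t, (ν i - μ i * Λ (Y * u))
        = (ν i * (Y * (t - s)) - μ i * ∫ u in (Y * s)..(Y * t), Λ u) / Y := by
      have h1 : IntervalIntegrable (fun u => Λ (Y * u)) volume s t := by
        have h := (hint i (Y * s) (Y * t) hYs0 hYst).comp_mul_left (c := Y)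
        simpa [mul_div_cancel_left₀ _ hY0.ne'] using h
      rw [intervalIntegral.integral_sub intervalIntegrable_const (h1.const_mul _),
        intervalIntegral.integral_const, intervalIntegral.integral_const_mul,
        intervalIntegral.integral_comp_mul_left _ hY0.ne', smul_eq_mul, smul_eq_mul]
      field_simp
    have hadj : (∫ u in (0 : ℝ)..(Y * t), Λ u) - ∫ u in (0 : ℝ)..(Y * s), Λ u
        = ∫ u in (Y * s)..(Y * t), Λ u :=
      intervalIntegral.integral_interval_sub_left (hint i 0 _ le_rfl (hYs0.trans hYst))
        (hint i 0 _ le_rfl hYs0)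
    have hb0 := hbound 0 (Y * s) le_rfl hYs0
    have hb1 := hbound 0 (Y * t) le_rfl (hYs0.trans hYst)
    have hb2 := hbound (Y * s) (Y * t) hYs0 hYst
    have hdt : Y * t - Y * s ≤ Y := by nlinarith
    have hdt0 : 0 ≤ Y * t - Y * s := sub_nonneg.2 hYst
    have hAdev := hA i (Y * s) (Y * t) hYs0 hYst (hYt t htR)
    have hSdev := hS i (∫ u in (0 : ℝ)..(Y * s), Λ u) (∫ u in (0 : ℝ)..(Y * t), Λ u) hb0.1
      (by linarith [hb2.1]) (hb1.2.trans (by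
        rw [sub_zero]
        exact mul_le_mul_of_nonneg_left (hYt t htR) hM0))
    rw [hadj] at hSdev
    set D := ∫ u in (Y * s)..(Y * t), Λ u
    have hDY : D ≤ M * Y := hb2.2.trans (mul_le_mul_of_nonneg_left hdt hM0)
    have hs' : (N (Y * s) i : ℝ) = N 0 i + A i (Y * s) - S i (∫ u in (0 : ℝ)..(Y * s), Λ u) := by
      exact_mod_cast hdyn i (Y * s) hYs0
    have ht' : (N (Y * t) i : ℝ) = N 0 i + A i (Y * t) - S i (∫ u in (0 : ℝ)..(Y * t), Λ u) := by
      exact_mod_cast hdyn i (Y * t) (hYs0.trans hYst)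
    have hν1 := abs_le.1 (hν' i)
    have hμ1 := abs_le.1 (hμ' i)
    -- the four sources of error
    have h1 : e * (r + ν' i * (Y * t - Y * s)) ≤ e * ((2 + ν i) * Y) := by
      refine mul_le_mul_of_nonneg_left ?_ he
      have h2 : ν' i * (Y * t - Y * s) ≤ (ν i + 1) * Y :=
        mul_le_mul (by linarith) hdt hdt0 (by linarith [hp.nu i])
      linarith
    have h2 : e * (r + μ' i * D) ≤ e * ((1 + (μ i + 1) * M) * Y) := by
      refine mul_le_mul_of_nonneg_left ?_ he
      have h3 : μ' i * D ≤ (μ i + 1) * (M * Y) :=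
        mul_le_mul (by linarith) hDY hb2.1 (by linarith [hp.mu i])
      linarith
    have h3 : |(ν' i - ν i) * (Y * t - Y * s)| ≤ e * Y := by
      rw [abs_mul, abs_of_nonneg hdt0]
      exact mul_le_mul (hν' i) hdt hdt0 he
    have h4 : |(μ' i - μ i) * D| ≤ e * (M * Y) := by
      rw [abs_mul, abs_of_nonneg hb2.1]
      exact mul_le_mul (hμ' i) hDY hb2.1 he
    have h5 := mul_le_mul_of_nonneg_right (hε i) hY0.le
    have hgoal : (N (Y * t) i : ℝ) / Y - N (Y * s) i / Y - ∫ u in s..t, (ν i - μ i * Λ (Y * u))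
        = (N (Y * t) i - N (Y * s) i - (ν i * (Y * (t - s)) - μ i * D)) / Y := by
      rw [hint']
      ring
    change |(N (Y * t) i : ℝ) / Y - N (Y * s) i / Y - ∫ u in s..t, (ν i - μ i * Λ (Y * u))| ≤ ε
    rw [hgoal, abs_div, abs_of_pos hY0, div_le_iff₀ hY0, hs', ht']
    rw [abs_le] at hAdev hSdev h3 h4 ⊢
    constructor <;> linarith [hAdev.1, hAdev.2, hSdev.1, hSdev.2, h3.1, h3.2, h4.1, h4.2]

end Paths

/-! ### Collapse of the scaled flow counts -/

section Collapse

theorem abs_le_eucl {ι : Type*} [Fintype ι] (x : ι → ℝ) (i : ι) : |x i| ≤ eucl x :=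
  PiLp.norm_apply_le (WithLp.toLp 2 x : EuclideanSpace ℝ ι) i

theorem eucl_le_sum {ι : Type*} [Fintype ι] (x : ι → ℝ) : eucl x ≤ ∑ i, |x i| := by
  unfold eucl
  rw [EuclideanSpace.norm_eq]
  refine Real.sqrt_le_iff.2 ⟨Finset.sum_nonneg fun i _ => abs_nonneg _, ?_⟩
  exact Finset.sum_sq_le_sq_sum_of_nonneg fun i _ => abs_nonneg _

theorem eucl_nonneg {ι : Type*} [Fintype ι] (x : ι → ℝ) : 0 ≤ eucl x := norm_nonneg _

theorem supNorm_nonneg {ι : Type*} [Fintype ι] (T : ℝ) (x : ℝ → ι → ℝ) : 0 ≤ supNorm T x :=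
  Real.iSup_nonneg fun _ => eucl_nonneg _

theorem eventually_forall_abs_sub_le {ι : Type*} [Fintype ι] (c : ι → ℝ) {e : ℝ} (he : 0 < e) :
    ∀ᶠ c' in 𝓝 c, ∀ i, |c' i - c i| ≤ e := by
  filter_upwards [Metric.ball_mem_nhds c he] with c' hc' i
  rw [← Real.dist_eq]
  exact (dist_le_pi_dist c' c i).trans (Metric.mem_ball.1 hc').le

variable {I J : Type*} [Fintype I] [Fintype J] [DecidableEq J]
variable {net : Network I J} {α : ℝ} {κ ν μ : I → ℝ}

/-- In the heavy traffic limit the offered load equals the capacity of every resource. Only this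
consequence of the convergence of `r (A ρ^r - C)` enters the argument. -/
theorem HeavyTraffic.critical_load {r : ℕ → ℝ} {νs μs : ℕ → I → ℝ} {θ : J → ℝ}
    (h : HeavyTraffic net r νs μs ν μ θ) (hr : Tendsto r atTop atTop) (j : J) :
    ∑ i, net.A j i * (ν i / μ i) = net.capacity j := by
  obtain ⟨-, hμ, hν', hμ', hθ⟩ := h
  have h1 : Tendsto (fun l => ∑ i, net.A j i * (νs l i / μs l i) - net.capacity j) atTop
      (𝓝 (∑ i, net.A j i * (ν i / μ i) - net.capacity j)) :=
    (tendsto_finsetSum _ fun i _ => ((tendsto_pi_nhds.1 hν' i).div (tendsto_pi_nhds.1 hμ' i)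
      (hμ i).ne').const_mul _).sub_const _
  have h2 : Tendsto (fun l => (r l)⁻¹ * (r l * (∑ i, net.A j i * (νs l i / μs l i)
      - net.capacity j))) atTop (𝓝 (0 * θ j)) := hr.inv_tendsto_atTop.mul (tendsto_pi_nhds.1 hθ j)
  have h3 := tendsto_nhds_unique (h2.congr' ?_) h1
  · linarith
  · filter_upwards [hr.eventually_gt_atTop 0] with l hl
    field_simp

/-- The flow counts on a bounded time interval are bounded if the arrivals are. -/
theorem exists_count_bound {N : ℝ → I → ℕ} {A : I → ℝ → ℕ} {D : I → ℝ → ℤ} {a : I → ℝ}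
    {r R e : ℝ} (hA : ∀ i, HasRate (A i) (a i) r R e) (ha : ∀ i, 0 ≤ a i) (he : 0 ≤ e)
    (hD : ∀ i t, 0 ≤ D i t) (hN : ∀ i t, 0 ≤ t → (N t i : ℤ) = N 0 i + A i t - D i t) :
    ∃ B, ∀ t, 0 ≤ t → t ≤ R → ∀ i, (N t i : ℝ) ≤ B := by
  obtain ⟨B, -, hB⟩ := exists_pos_forall_ge fun i =>
    (N 0 i : ℝ) + A i 0 + a i * R + e * (r + a i * R)
  refine ⟨B, fun t ht htR i => le_trans ?_ (hB i)⟩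
  have h1 := (abs_le.1 (hA i 0 t le_rfl ht htR)).2
  have h2 : (N t i : ℝ) ≤ N 0 i + A i t := by
    have h3 := hN i t ht
    have h4 := hD i t
    exact_mod_cast (by omega : (N t i : ℤ) ≤ N 0 i + A i t)
  rw [sub_zero] at h1
  have h5 := mul_le_mul_of_nonneg_left htR (ha i)
  have h6 := mul_le_mul_of_nonneg_left h5 he
  linarith

/-- The deterministic core: on a sample path along which arrivals and services keep to their
rates, collapse at time zero implies collapse over `[0, T]`. -/
theorem exists_collapse_of_hasRate (hp : PosParams α κ ν μ) (hrow : ∀ j, ∃ i, j ∈ net.route i)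
    (hcrit : ∀ j, ∑ i, net.A j i * (ν i / μ i) = net.capacity j) {M : ℝ} (hM0 : 0 ≤ M)
    (hM : ∀ x : I → ℝ, (∀ i, 0 ≤ x i) → (∀ j, ∑ i, net.A j i * x i ≤ net.capacity j) →
      ∀ i, x i ≤ M) {ε : ℝ} (hε : 0 < ε) :
    ∃ δ > 0, ∃ e > 0, e ≤ 1 / 4 ∧ ∀ᶠ μ' in 𝓝 μ, ∀ ν' : I → ℝ,
      (∀ i, |ν' i - ν i| ≤ 3 * e) → (∀ i, 0 < ν' i) → ∀ (r T : ℝ), 0 < r → 0 < T →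
      ∀ (N : ℝ → I → ℕ) (A S : I → ℝ → ℕ),
        (∀ t, 0 ≤ t → ContinuousWithinAt N (Set.Ici t) t) →
        (∀ i, HasRate (A i) (ν' i) r (T * r ^ 2) (3 * e)) →
        (∀ i, HasRate (S i) (μ' i) r (M * T * r ^ 2) (3 * e)) →
        (∀ i t, 0 ≤ t → (N t i : ℤ) = N 0 i + A i t
          - S i (∫ s in (0 : ℝ)..t, allocation net α κ (fun i' => (N s i' : ℝ)) i)) →
        let X : ℝ → I → ℝ := fun t i => (N (r ^ 2 * t) i : ℝ) / r
        eucl (X 0 - lift net α κ ν μ (workload net μ' (X 0))) < δ →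
        supNorm T (fun t => X t - lift net α κ ν μ (workload net μ' (X t)))
          ≤ ε * max (supNorm T X) 1 := by
  obtain ⟨k, hk0, hk⟩ := exists_pos_forall_ge fun _ : Unit => (Fintype.card I : ℝ)
  replace hk := hk ()
  obtain ⟨δ₁, hδ₁, hnear⟩ := exists_near_lift_of_costGap_le hp hrow (show 0 < ε / k by positivity)
  obtain ⟨ε₁, hε₁, hfluid⟩ := exists_costGap_le_of_isNearFluid hp hrow hcrit
    (show 0 < δ₁ / 3 by positivity)
  obtain ⟨δ, hδ, hinit⟩ := exists_costGap_le_of_near_lift hp hrow (show 0 < δ₁ / 3 by positivity)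
  obtain ⟨B, hB0, hB⟩ := exists_pos_forall_ge fun i => 4 + ν i + (μ i + 2) * M
  obtain ⟨e, he0, he4, heB⟩ : ∃ e > 0, e ≤ 1 / 4 ∧ B * (3 * e) ≤ ε₁ := by
    refine ⟨min (1 / 4) (ε₁ / (B * 3)), by positivity, min_le_left _ _, ?_⟩
    rw [← mul_assoc, mul_comm, ← le_div_iff₀ (by positivity)]
    exact min_le_right _ _
  refine ⟨δ, hδ, e, he0, he4, ?_⟩
  filter_upwards [hnear, hinit, eventually_forall_abs_sub_le μ (show 0 < 3 * e by positivity)]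
    with μ' hnear hinit hμ' ν' hν' hν'0 r T hr hT N A S hN hA hS hdyn X hX0
  have hbdd : BddAbove (Set.range fun t : Set.Icc (0 : ℝ) T => eucl (X t)) := by
    obtain ⟨B, hB⟩ := exists_count_bound hA (fun i => (hν'0 i).le) (by positivity)
      (fun i t => Int.natCast_nonneg (S i (∫ s in (0 : ℝ)..t,
        allocation net α κ (fun i' => (N s i' : ℝ)) i))) hdyn
    refine ⟨∑ _i : I, B / r, ?_⟩
    rintro _ ⟨t, rfl⟩
    refine (eucl_le_sum _).trans (Finset.sum_le_sum fun i _ => ?_)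
    rw [abs_of_nonneg (by positivity)]
    refine div_le_div_of_nonneg_right (hB _ (mul_nonneg (sq_nonneg r) t.2.1) ?_ i) hr.le
    rw [mul_comm]
    exact mul_le_mul_of_nonneg_right t.2.2 (sq_nonneg r)
  -- the states are normalized by their maximal size `Y = r * c` over the whole time interval
  set c := max (supNorm T X) 1
  have hc1 : 1 ≤ c := le_max_right _ _
  have hc0 : 0 < c := by linarith
  have hY0 : 0 < r * c := by positivity
  have hYr : r ≤ r * c := le_mul_of_one_le_right hr.le hc1
  have hNY : ∀ t, 0 ≤ t → t ≤ T * r ^ 2 → ∀ i, (N t i : ℝ) ≤ r * c := fun t ht htR i => by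
    have ht' : t / r ^ 2 ∈ Set.Icc (0 : ℝ) T :=
      ⟨by positivity, by rwa [div_le_iff₀ (by positivity)]⟩
    have h1 : eucl (X (t / r ^ 2)) ≤ supNorm T X := le_ciSup hbdd ⟨t / r ^ 2, ht'⟩
    have h2 := (le_abs_self _).trans ((abs_le_eucl _ i).trans (h1.trans (le_max_left _ 1)))
    have h3 : X (t / r ^ 2) i = N t i / r := by
      simp only [X]
      rw [mul_div_cancel₀ _ (by positivity)]
    rw [h3, div_le_iff₀ hr] at h2
    linarith
  have hnf := isNearFluid_of_hasRate hp hN hr hYr (by positivity : 0 ≤ 3 * e) (by linarith) hM hM0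
    hν' hμ' (fun i => (mul_le_mul_of_nonneg_right (hB i) (by positivity)).trans heB) hA
    (by rwa [mul_assoc] at hS) hdyn hNY
  set n : ℝ → I → ℝ := fun t i => (N (r * c * t) i : ℝ) / (r * c)
  have hXn : ∀ t, X t = c • n (r ^ 2 * t / (r * c)) := fun t => by
    funext i
    simp only [X, n, Pi.smul_apply, smul_eq_mul]
    rw [mul_div_cancel₀ _ hY0.ne']
    field_simp
  have hdiff : ∀ t, X t - lift net α κ ν μ (workload net μ' (X t))
      = c • (n (r ^ 2 * t / (r * c))
        - lift net α κ ν μ (workload net μ' (n (r ^ 2 * t / (r * c))))) := fun t => by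
    rw [hXn, workload_smul, lift_smul hp hrow hc0, smul_sub]
  have hR0 : 0 ≤ T * r ^ 2 / (r * c) := by positivity
  have h0 : costGap net α κ ν μ (n 0) ≤ δ₁ / 3 := by
    refine hinit (n 0) (hnf.nonneg 0 le_rfl hR0) (hnf.le_one 0 le_rfl hR0) fun i => ?_
    have h1 := (abs_le_eucl _ i).trans hX0.le
    rw [hdiff 0, mul_zero, zero_div, Pi.smul_apply, smul_eq_mul, abs_mul, abs_of_pos hc0,
      Pi.sub_apply] at h1
    exact (le_mul_of_one_le_left (abs_nonneg _) hc1).trans h1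
  have : Nonempty (Set.Icc (0 : ℝ) T) := ⟨⟨0, le_rfl, hT.le⟩⟩
  refine ciSup_le fun t => ?_
  have hu0 : 0 ≤ r ^ 2 * (t : ℝ) / (r * c) := by
    have := t.2.1
    positivity
  have huR : r ^ 2 * (t : ℝ) / (r * c) ≤ T * r ^ 2 / (r * c) := by
    refine div_le_div_of_nonneg_right ?_ hY0.le
    rw [mul_comm]
    exact mul_le_mul_of_nonneg_right t.2.2 (sq_nonneg r)
  have h1 := hfluid _ n _ hnf h0 _ hu0 huR
  have h2 := hnear _ (hnf.nonneg _ hu0 huR) (hnf.le_one _ hu0 huR) (by linarith)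
  change eucl (X t - lift net α κ ν μ (workload net μ' (X t))) ≤ ε * c
  refine (eucl_le_sum _).trans ?_
  rw [hdiff]
  calc _ ≤ ∑ _i : I, c * (ε / k) := by
        refine Finset.sum_le_sum fun i _ => ?_
        rw [Pi.smul_apply, smul_eq_mul, abs_mul, abs_of_pos hc0]
        exact mul_le_mul_of_nonneg_left (h2 i) hc0.le
    _ ≤ k * (c * (ε / k)) := by
        rw [Finset.sum_const, Finset.card_univ, nsmul_eq_mul]
        exact mul_le_mul_of_nonneg_right hk (by positivity)
    _ = ε * c := by field_simp

end Collapse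
end FlowLevel

theorem theorem5p1 {I J : Type*} [Fintype I] [Nonempty I] [Fintype J] [Nonempty J] [DecidableEq J]
    (net : FlowLevel.Network I J) (α : ℝ) (hα : 0 < α) (κ : I → ℝ) (hκ : ∀ i, 0 < κ i)
    (r : ℕ → ℝ) (hr_pos : ∀ l, 0 < r l) (hr_mono : Monotone r) (hr : Tendsto r atTop atTop)
    (νs μs : ℕ → I → ℝ) (hνs : ∀ l i, 0 < νs l i) (hμs : ∀ l i, 0 < μs l i)
    (ν μ : I → ℝ) (θ : J → ℝ) (hHT : FlowLevel.HeavyTraffic net r νs μs ν μ θ)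
    {Ω : ℕ → Type*} [∀ l, MeasurableSpace (Ω l)] (P : ∀ l, Measure (Ω l))
    [∀ l, IsProbabilityMeasure (P l)]
    (S : ∀ l, FlowLevel.Model net α κ (νs l) (μs l) (P l))
    (hinit : FlowLevel.TendstoZeroInProb P fun l ω =>
      FlowLevel.eucl ((S l).scaledCount (r l) 0 ω
        - FlowLevel.lift net α κ ν μ ((S l).scaledWork (r l) 0 ω))) :
    FlowLevel.MultiplicativeCollapse r S ν μ := by
  open FlowLevel in
  have hp : PosParams α κ ν μ := ⟨hα, hκ, hHT.1, hHT.2.1⟩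
  have hcrit := hHT.critical_load hr
  -- every resource is used, since its capacity is positive
  have hrow : ∀ j, ∃ i, j ∈ net.route i := fun j => by
    by_contra! h
    have h1 := hcrit j
    rw [Finset.sum_eq_zero fun i _ => by simp [Network.A, incidence, h i]] at h1
    exact (net.capacity_pos j).ne h1
  obtain ⟨M, hM0, hM⟩ := exists_allocation_bound net
  intro T hT ε hε
  obtain ⟨δ, hδ, e, he, he4, hcol⟩ :=
    exists_collapse_of_hasRate hp hrow hcrit hM0.le hM (half_pos hε)
  have hνlim := hHT.2.2.1
  have hμlim := hHT.2.2.2.1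
  have hbound : ∀ (c : I → ℝ) (cs : ℕ → I → ℝ), Tendsto cs atTop (𝓝 c) → ∀ i,
      ∀ᶠ l in atTop, cs l i ≤ c i + 1 := fun c cs h i =>
    ((tendsto_pi_nhds.1 h i).eventually_lt_const (lt_add_one (c i))).mono fun _ h => h.le
  let badA : ∀ l, I → Set (Ω l) := fun l i =>
    {ω | ¬ HasRate (renewalCount fun k => (S l).interarrival i k ω) (νs l i) (r l)
      (T * r l ^ 2) (3 * e)}
  let badS : ∀ l, I → Set (Ω l) := fun l i =>
    {ω | ¬ HasRate (renewalCount fun k => (S l).docSize i k ω) (μs l i) (r l)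
      (M * T * r l ^ 2) (3 * e)}
  have hA : ∀ i, Tendsto (fun l => P l (badA l i)) atTop (𝓝 0) := fun i =>
    tendsto_measure_not_hasRate P (fun l => (S l).interarrival i) (fun l => hνs l i)
      (hbound ν νs hνlim i) hr hT.le he he4 (fun l => (S l).measurable_interarrival i)
      (fun l => (S l).law_interarrival i) fun l => (S l).indep_primitives.precomp
        (g := fun k : ℕ => Sum.inl (i, k)) fun k k' h => by simpa using h
  have hS : ∀ i, Tendsto (fun l => P l (badS l i)) atTop (𝓝 0) := fun i =>
    tendsto_measure_not_hasRate P (fun l => (S l).docSize i) (fun l => hμs l i)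
      (hbound μ μs hμlim i) hr (by positivity) he he4 (fun l => (S l).measurable_docSize i)
      (fun l => (S l).law_docSize i) fun l => (S l).indep_primitives.precomp
        (g := fun k : ℕ => Sum.inr (i, k)) fun k k' h => by simpa using h
  have hlim := ((hinit δ hδ).add (tendsto_finsetSum Finset.univ fun i _ => hA i)).add
    (tendsto_finsetSum Finset.univ fun i _ => hS i)
  simp only [Finset.sum_const_zero, add_zero] at hlim
  refine tendsto_of_tendsto_of_tendsto_of_le_of_le' tendsto_const_nhds hlim
    (Eventually.of_forall fun _ => zero_le) ?_
  filter_upwards [hμlim.eventually hcol,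
    hνlim.eventually (eventually_forall_abs_sub_le ν (show 0 < 3 * e by positivity))] with l hl hνl
  let init : Set (Ω l) := {ω | δ ≤ |eucl ((S l).scaledCount (r l) 0 ω
    - FlowLevel.lift net α κ ν μ ((S l).scaledWork (r l) 0 ω))|}
  calc P l _ ≤ P l (init ∪ (⋃ i, badA l i) ∪ ⋃ i, badS l i) := by
        refine measure_mono_ae ?_
        filter_upwards [(S l).dynamics] with ω hdyn hω
        by_contra hcon
        have hcon' : ω ∉ init ∪ (⋃ i, badA l i) ∪ ⋃ i, badS l i := hcon
        simp only [Set.mem_union, Set.mem_iUnion, not_or, not_exists, badA, badS, init,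
          Set.mem_ofPred_eq, not_le, not_not] at hcon'
        obtain ⟨⟨h1, h2⟩, h3⟩ := hcon'
        have hwork : ∀ t, (S l).scaledWork (r l) t ω
            = workload net (μs l) ((S l).scaledCount (r l) t ω) := fun t => by
          funext j
          simp only [Model.scaledWork, Model.work, Model.scaledCount, workload, Finset.sum_div]
          exact Finset.sum_congr rfl fun i _ => by ring
        have h := hl (νs l) hνl (hνs l) (r l) T (hr_pos l) hT (fun t => (S l).count t ω) _ _
          ((S l).rcll ω).1 h2 h3 hdyn (by
            rw [abs_of_nonneg (eucl_nonneg _), hwork] at h1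
            exact h1)
        have hω' : ε ≤ |supNorm T (fun t => (S l).scaledCount (r l) t ω
            - FlowLevel.lift net α κ ν μ ((S l).scaledWork (r l) t ω))
            / max (supNorm T fun t => (S l).scaledCount (r l) t ω) 1| := hω
        simp only [hwork] at hω'
        have hmax : 0 < max (supNorm T fun t => (S l).scaledCount (r l) t ω) 1 := by positivity
        rw [abs_of_nonneg (div_nonneg (supNorm_nonneg _ _) hmax.le),
          le_div_iff₀ hmax] at hω'
        have h4 := hω'.trans h
        have h5 := mul_pos hε hmax
        change ε * max (supNorm T fun t => (S l).scaledCount (r l) t ω) 1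
          ≤ ε / 2 * max (supNorm T fun t => (S l).scaledCount (r l) t ω) 1 at h4
        linarith
    _ ≤ P l init + ∑ i, P l (badA l i) + ∑ i, P l (badS l i) :=
        (measure_union_le _ _).trans (add_le_add ((measure_union_le _ _).trans
          (add_le_add le_rfl (measure_iUnion_fintype_le _ _))) (measure_iUnion_fintype_le _ _))
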